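/- **Setting.** Let $\mathcal B=\{\mathcal B^{s}\}_{s\in\mathbb N}$ be a scale of real Banach spaces: $\mathcal B^{s}\subset\mathcal B^{s'}$ with bounded inclusion for $s\ge s'$. For $s$ large, say $s\ge m$, $\mathcal B^s$ is continuously embedded in a real Hilbert space with scalar product $\langle\cdot,\cdot\rangle$. Let $J$ be a linear operator, bounded from $\mathcal B^m$ to $\mathcal B^0$, such that for every $s$ there is $s'$ with $J:\mathcal B^{s'}\to\mathcal B^{s}$ bounded, and skew-symmetric: $\langle Jz,w\rangle=-\langle z,Jw\rangle$ whenever $z,w,Jz,Jw\in\mathcal B^m$. Assume that there are linear truncations $\Pi_N$, $N\in\mathbb N$, bounded from every space of the scale to every other one, self-adjoint for $\langle\cdot,\cdot\rangle$, commuting with $J$, with $\Pi_Nz\to z$ in $\mathcal B^s$ as $N\to\infty$ for every $z\in\mathcal B^s$. A map $F$ is *almost smooth* if for all $k,s'\ge 0$ there are $s$ and an open neighbourhood $\mathcal U$ of the origin of $\mathcal B^s$ such that $F\in C^k(\mathcal U;\mathcal B^{s'})$. A map depending on a parameter $\epsilon\in\mathbb R$ is almost smooth if for all $k,s'$ it is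 $C^k$ jointly in $(z,\epsilon)$, with values in $\mathcal B^{s'}$, on some $\mathcal V\times(-\delta,\delta)$ with $\delta>0$ and $\mathcal V$ an open neighbourhood of the origin of some $\mathcal B^s$. The gradient $\nabla F(z)$ is defined by $dF(z)h=\langle\nabla F(z),h\rangle$. We say that $w\in\mathcal B^m$ is $J\nabla F(z)$ *in the weak sense* if $\langle w,h\rangle=-dF(z)(Jh)$ for all $h\in\bigcap_s\mathcal B^s$; such a $w$ is unique, and it is $J\nabla F(z)$ whenever $\nabla F(z)$ exists in $\mathcal B^m$ and $J\nabla F(z)\in\mathcal B^m$. Let $G,H$ be real functions of class $C^1$ on an open neighbourhood of the origin of some $\mathcal B^{s}$ with $s\ge m$, with gradients there belonging to $\mathcal B^m$, and such that the vector fields $X:=J\nabla G$ and $J\nabla H$ are almost smooth. Fix an integer $r\ge1$ and put $$X^{(0)}:=X,\quad X^{(k)}:=dX^{(k-1)}X,\qquad H^{(0)}:=H,\quad H^{(l)}:=\{H^{(l-1)};G\}=dH^{(l-1)}X,$$ $$T_\epsilon(z):=z+\sum_{k=0}^{r-1}\frac{\epsilon^{k+1}}{(k+1)!}X^{(k)}(z),\qquad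 \widetilde H_\epsilon:=\sum_{l=0}^{r}\frac{\epsilon^l}{l!}H^{(l)} .$$ **Theorem.** (a) There are an almost smooth family of vector fields $W_\epsilon$ and a neighbourhood of the origin of some $\mathcal B^s$ on which, for all $\epsilon$, $\widetilde H_\epsilon$ is of class $C^1$ and $J\nabla\widetilde H_\epsilon=W_\epsilon$ in the weak sense. (b) For every $s'$ there exist $s,s''\ge m$ with $s''\ge s'$, an open neighbourhood $\mathcal U\subset\mathcal B^s$ of the origin, $\epsilon_0>0$ and $C$ with the following property. Let $|\epsilon|<\epsilon_0$ and $0<T_0\le\infty$, and let $\zeta\in C^1([-T_0,T_0];\mathcal U)$ (with $[-T_0,T_0]=\mathbb R$ if $T_0=\infty$) be a solution of $$\dot\zeta=J\nabla\widetilde H_\epsilon(\zeta)$$ in the weak sense. Then $z(t):=T_\epsilon(\zeta(t))$ belongs to $C^1([-T_0,T_0];\mathcal B^{s''})$, $\nabla H(z(t))$ exists in $\mathcal B^m$ for all $t\in[-T_0,T_0]$, and there is $R\in C^1([-T_0,T_0];\mathcal B^{s'})$ with $\|R(t)\|_{\mathcal B^{s'}}\le C$ and $\|\dot R(t)\|_{\mathcal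 B^{s'}}\le C$ for all $t\in[-T_0,T_0]$, such that $$\dot z(t)=J\nabla H(z(t))+\epsilon^{r+1}R(t)\qquad\text{for all }t\in[-T_0,T_0].$$ -/

import Mathlib

open Filter Topology Set
open scoped RealInnerProductSpace

noncomputable section

/-- A scale of Banach spaces `B 0 ⊇ B 1 ⊇ B 2 ⊇ ⋯`: the inclusions are represented by injective
bounded linear maps which are compatible with each other. -/
structure BanachScale (B : ℕ → Type*) [∀ s, NormedAddCommGroup (B s)]
    [∀ s, NormedSpace ℝ (B s)] where
  /-- the inclusion of `B s` into `B s'` for `s' ≤ s` -/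
  incl : ∀ {s' s : ℕ}, s' ≤ s → B s →L[ℝ] B s'
  incl_injective : ∀ {s' s : ℕ} (h : s' ≤ s), Function.Injective (incl h)
  incl_refl : ∀ (s : ℕ) (z : B s), incl (le_refl s) z = z
  incl_trans : ∀ {s'' s' s : ℕ} (h : s'' ≤ s') (h' : s' ≤ s) (z : B s),
    incl h (incl h' z) = incl (h.trans h') z

namespace BanachScale

variable {B : ℕ → Type*} [∀ s, NormedAddCommGroup (B s)] [∀ s, NormedSpace ℝ (B s)]

/-- The inclusion of `B s` into the largest space `B 0`. Maps between (neighbourhoods of the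
origin in) spaces of the scale are represented by functions on `B 0`, of which only the values at
points of `B s`, `s` large, near the origin matter. -/
def ι (S : BanachScale B) (s : ℕ) : B s →L[ℝ] B 0 := S.incl (Nat.zero_le s)

/-- Almost smooth maps from the scale to itself: for all `k`, `s'` there is `s` such that `F` is
a `C^k` map from an open neighbourhood of the origin of `B s` to `B s'`. -/
def AlmostSmooth (S : BanachScale B) (F : B 0 → B 0) : Prop :=
  ∀ k s' : ℕ, ∃ (s : ℕ) (U : Set (B s)) (f : B s → B s'),
    IsOpen U ∧ 0 ∈ U ∧ ContDiffOn ℝ k f U ∧ ∀ z ∈ U, S.ι s' (f z) = F (S.ι s z)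

/-- Almost smooth maps depending on a small parameter `ε`: the domains are products of an open
neighbourhood `V` of the origin of `B s`, independent of `ε`, and an interval `(-δ, δ)`. -/
def AlmostSmoothFamily (S : BanachScale B) (F : ℝ → B 0 → B 0) : Prop :=
  ∀ k s' : ℕ, ∃ (s : ℕ) (V : Set (B s)) (δ : ℝ) (f : B s × ℝ → B s'),
    IsOpen V ∧ 0 ∈ V ∧ 0 < δ ∧ ContDiffOn ℝ k f (V ×ˢ Ioo (-δ) δ) ∧
      ∀ z ∈ V, ∀ ε ∈ Ioo (-δ) δ, S.ι s' (f (z, ε)) = F ε (S.ι s z)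

end BanachScale

/-- The iterated vector fields `X^(0) = X`, `X^(k+1) = dX^(k) X`. The differential is taken in
`B 0`; if `F` is `C^1` from an open subset of `B s` to some `B s'`, then for `z` in this set and
`v` in `B s`, `lineDeriv ℝ F z v` is the Fréchet differential `dF(z) v`. -/
def iterField {V : Type*} [NormedAddCommGroup V] [NormedSpace ℝ V] (X : V → V) : ℕ → V → V
  | 0 => X
  | k + 1 => fun z => lineDeriv ℝ (iterField X k) z (X z)

/-- The truncated flow expansion `T(z) = z + ∑_{k=0}^{r-1} ε^(k+1)/(k+1)! X^(k)(z)`. -/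
def truncFlow {V : Type*} [NormedAddCommGroup V] [NormedSpace ℝ V] (X : V → V) (r : ℕ) (ε : ℝ)
    (z : V) : V :=
  z + ∑ k ∈ Finset.range r, (ε ^ (k + 1) / ((k + 1).factorial : ℝ)) • iterField X k z

/-- The iterated Poisson brackets `H^(0) = H`, `H^(l+1) = {H^(l); G} = dH^(l) X`, where
`X = J∇G`. -/
def iterBracket {V : Type*} [NormedAddCommGroup V] [NormedSpace ℝ V] (X : V → V) (H : V → ℝ) :
    ℕ → V → ℝ
  | 0 => H
  | l + 1 => fun z => lineDeriv ℝ (iterBracket X H l) z (X z)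

/-- The truncated Lie series `∑_{l=0}^{r} ε^l/l! H^(l)`. -/
def truncLie {V : Type*} [NormedAddCommGroup V] [NormedSpace ℝ V] (X : V → V) (H : V → ℝ)
    (r : ℕ) (ε : ℝ) (z : V) : ℝ :=
  ∑ l ∈ Finset.range (r + 1), (ε ^ l / (l.factorial : ℝ)) * iterBracket X H l z

/-- The Hamiltonian setting: a scale of Banach spaces whose spaces `B s`, `s ≥ m`, are embedded in
a Hilbert space `E`, a skew-symmetric Poisson tensor `J`, and truncation operators. -/
structure HamiltonianScale (B : ℕ → Type*) [∀ s, NormedAddCommGroup (B s)]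
    [∀ s, NormedSpace ℝ (B s)] (E : Type*) [NormedAddCommGroup E] [InnerProductSpace ℝ E]
    extends BanachScale B where
  /-- the index from which on the spaces embed in `E`, and `J` is bounded with values in `B 0` -/
  m : ℕ
  /-- the embedding into the Hilbert space -/
  toE : B m →L[ℝ] E
  toE_injective : Function.Injective toE
  /-- the Poisson tensor -/
  J : B m →L[ℝ] B 0
  /-- for every `s` there is `s'` such that `J` is bounded from `B s'` to `B s` -/
  J_bounded : ∀ s : ℕ, ∃ (s' : ℕ) (h : m ≤ s') (Js : B s' →L[ℝ] B s),
    ∀ z : B s', toBanachScale.ι s (Js z) = J (incl h z)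
  /-- `⟨J z, w⟩ = -⟨z, J w⟩` whenever `J z = z'` and `J w = w'` belong to `B m` -/
  J_skew : ∀ z w z' w' : B m, J z = toBanachScale.ι m z' → J w = toBanachScale.ι m w' →
    ⟪toE z', toE w⟫ = -⟪toE z, toE w'⟫
  /-- the truncation operators `Π_N`, bounded from each space of the scale to each other one -/
  proj : ℕ → ∀ s : ℕ, B 0 →L[ℝ] B s
  proj_compat : ∀ (N s : ℕ) (z : B 0), toBanachScale.ι s (proj N s z) = proj N 0 z
  /-- `Π_N` converges (strongly) to the identity -/
  proj_tendsto : ∀ (s : ℕ) (z : B s),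
    Tendsto (fun N => proj N s (toBanachScale.ι s z)) atTop (𝓝 z)
  /-- `Π_N` is self-adjoint -/
  proj_selfAdjoint : ∀ (N : ℕ) (z w : B m),
    ⟪toE (proj N m (toBanachScale.ι m z)), toE w⟫ = ⟪toE z, toE (proj N m (toBanachScale.ι m w))⟫
  /-- `Π_N` commutes with `J` -/
  proj_comm_J : ∀ (N : ℕ) (z : B m), J (proj N m (toBanachScale.ι m z)) = proj N 0 (J z)

namespace HamiltonianScale

variable {B : ℕ → Type*} [∀ s, NormedAddCommGroup (B s)] [∀ s, NormedSpace ℝ (B s)]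
  {E : Type*} [NormedAddCommGroup E] [InnerProductSpace ℝ E]

/-- `g = ∇F(z)`: `F` is differentiable at `z` as a function on `B s`, and
`dF(z) h = ⟨g, h⟩` for all `h` in `B s`. -/
def IsGradientAt (S : HamiltonianScale B E) (F : B 0 → ℝ) {s : ℕ} (hs : S.m ≤ s) (z : B s)
    (g : B S.m) : Prop :=
  HasFDerivAt (fun x : B s => F (S.ι s x))
    ((innerSL ℝ (S.toE g)).comp (S.toE.comp (S.incl hs))) z

/-- `F` is of class `C^1` near the origin of some `B s`, its gradient exists there and is in the
domain of `J`, and `X = J∇F`. -/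
def IsHamiltonianField (S : HamiltonianScale B E) (F : B 0 → ℝ) (X : B 0 → B 0) : Prop :=
  ∃ (s : ℕ) (hs : S.m ≤ s) (U : Set (B s)), IsOpen U ∧ 0 ∈ U ∧
    ContDiffOn ℝ 1 (fun x : B s => F (S.ι s x)) U ∧
    ∀ z ∈ U, ∃ g : B S.m, S.IsGradientAt F hs z g ∧ S.J g = X (S.ι s z)

/-- `w = J∇F(z)` in the weak sense: `⟨w, h⟩ = -dF(z)(J h)` for all `h` in `⋂ s, B s`. By the
convergence of the truncations there is at most one such `w`, and by `isHamVec_of_gradient` below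
it is `J∇F(z)` whenever `F` has a gradient at `z` in the domain of `J`. -/
def IsHamVec (S : HamiltonianScale B E) (F : B 0 → ℝ) (z : B 0) (w : B S.m) : Prop :=
  ∀ h : B S.m, (∀ s : ℕ, ∃ h' : B s, S.ι s h' = S.ι S.m h) →
    ⟪S.toE w, S.toE h⟫ = -lineDeriv ℝ F z (S.J h)

theorem isHamVec_of_gradient (S : HamiltonianScale B E) (F : B 0 → ℝ) {s : ℕ} (hs : S.m ≤ s)
    (z : B s) (g w : B S.m) (hg : S.IsGradientAt F hs z g) (hw : S.J g = S.ι S.m w) :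
    S.IsHamVec F (S.ι s z) w := by
  intro h hh
  obtain ⟨s', hs', Js, hJs⟩ := S.J_bounded s
  obtain ⟨h', hh'⟩ := hh s'
  have e1 : S.incl hs' h' = h := by
    apply S.incl_injective (Nat.zero_le S.m)
    rw [S.incl_trans]
    exact hh'
  have e2 : S.J h = S.ι s (Js h') := by rw [hJs, e1]
  have e3 : S.J h = S.ι S.m (S.incl hs (Js h')) := by
    rw [e2]
    exact (S.incl_trans (Nat.zero_le S.m) hs (Js h')).symm
  rw [S.J_skew g h w _ hw e3, e2]
  congr 1
  have h1 := (hg.hasLineDerivAt (Js h')).lineDeriv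
  have h2 : lineDeriv ℝ F (S.ι s z) (S.ι s (Js h'))
      = lineDeriv ℝ (fun x : B s => F (S.ι s x)) z (Js h') := by
    simp [lineDeriv]
  rw [h2, h1]
  simp

end HamiltonianScale

/-- The interval `[-T₀, T₀]`, `0 < T₀ ≤ ∞` (all of `ℝ` for `T₀ = ∞`). -/
def timeInterval (T₀ : EReal) : Set ℝ := {t | ((|t| : ℝ) : EReal) ≤ T₀}

end

/-!
The argument has two parts: a structural one on Poisson brackets, and a comparison of Taylor
expansions in `ε`.

**Brackets.** Let `F` be of class `C^1` with an almost smooth weak Hamiltonian field `W`, and let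
`X = J∇G`. Approximating a gradient `q` by `Π_N q` shows `dF(z) u = -⟨W(z), q⟩` whenever `J q = u`
(`IsHamVec.fderiv_eq`). Applied to `q = ∇G(y)` and to `q = ∇G(y) - ∇G(z)`, it gives for
`f = {F; G} = dF X` the exact identity
`f(y) - f(z) = dF(z)(X(y) - X(z)) - dG(y)(W(y) - W(z))`,
so `f` is of class `C^1` with `df = dF dX - dG dW`, although `dF` and `dG` are merely continuous.
On a vector `J h` the two terms are mixed second derivatives of `G` and of `F`, of which one order
of differentiation is known to give a continuous function; so the other order exists and agrees
(`hasDerivAt_fderiv_of_hasStrictFDerivAt`). Hence `f` has the weak field `[X, W] = dW X - dX W`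
(`HasWeakField.bracket`), and the truncated Lie series of `H` has as weak field the truncated Lie
series `W_ε` of `J∇H`.

**Expansion.** Put `T = T_ε` and `Y = J∇H`. The truncated exponential sums solve
`∂_ε T = dT X` and `∂_ε W = [X, W]` up to `ε ^ r` times smooth terms. As the derivations `∂_ε`,
`∂_X` and `∂_W` satisfy the usual commutator rule, `Φ = dT W - Y(T)` solves `∂_ε Φ = dΦ X` up to
`ε ^ r` times a smooth term, and `Φ = 0` for `ε = 0`. Hadamard's lemma
(`Smooth.exists_eq_pow_smul`), applied repeatedly, yields `Φ = ε ^ (r + 1) Q` with `Q` almost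
smooth (`Smooth.exists_conjugation_eq`); no flow of `X` is used, and in general there is none. Weak
Hamiltonian vectors being unique, a solution `ζ` satisfies `ζ' = W_ε(ζ)`, whence
`(T(ζ))' = dT(ζ) W_ε(ζ) = Y(T(ζ)) + ε ^ (r + 1) Q(ζ, ε)`.

Each differentiation and each composition loses derivatives, that is, shrinks the domain to a finer
space of the scale. The bookkeeping is done with the filter `BanachScale.nhdsE`, generated by the
neighbourhoods of the origin of all the spaces, and with the predicate `BanachScale.Smooth` on
germs along it.
-/

noncomputable section

universe u

/-! ### Germs of maps on a scale, depending on a parameter -/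

namespace BanachScale

variable {B : ℕ → Type*} [∀ s, NormedAddCommGroup (B s)] [∀ s, NormedSpace ℝ (B s)]

/-- The inclusion `B s × ℝ → B s' × ℝ`; the second factor carries the parameter `ε`. -/
def inclE (S : BanachScale B) {s' s : ℕ} (h : s' ≤ s) : B s × ℝ →L[ℝ] B s' × ℝ :=
  (S.incl h).prodMap (ContinuousLinearMap.id ℝ ℝ)

/-- The inclusion `B s × ℝ → B 0 × ℝ`. -/
def ιE (S : BanachScale B) (s : ℕ) : B s × ℝ →L[ℝ] B 0 × ℝ := S.inclE (Nat.zero_le s)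

theorem inclE_apply (S : BanachScale B) {s' s : ℕ} (h : s' ≤ s) (p : B s × ℝ) :
    S.inclE h p = (S.incl h p.1, p.2) := rfl

theorem ιE_apply (S : BanachScale B) (s : ℕ) (p : B s × ℝ) : S.ιE s p = (S.ι s p.1, p.2) := rfl

theorem ι_injective (S : BanachScale B) (s : ℕ) : Function.Injective (S.ι s) :=
  S.incl_injective _

theorem ι_incl (S : BanachScale B) {s' s : ℕ} (h : s' ≤ s) (z : B s) :
    S.ι s' (S.incl h z) = S.ι s z := S.incl_trans _ h z

theorem ιE_inclE (S : BanachScale B) {s' s : ℕ} (h : s' ≤ s) (p : B s × ℝ) :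
    S.ιE s' (S.inclE h p) = S.ιE s p := by
  simp [ιE_apply, inclE_apply, ι_incl]

theorem tendsto_inclE (S : BanachScale B) {s' s : ℕ} (h : s' ≤ s) :
    Tendsto (S.inclE h) (𝓝 0) (𝓝 0) := by
  simpa using (S.inclE h).continuous.tendsto 0

theorem tendsto_incl (S : BanachScale B) {s' s : ℕ} (h : s' ≤ s) :
    Tendsto (S.incl h) (𝓝 0) (𝓝 0) := by
  simpa using (S.incl h).continuous.tendsto 0

/-- The filter on `B 0 × ℝ` generated by the neighbourhoods of the origin in the finer spaces:
a property holds eventually if it holds on a neighbourhood of the origin of some `B s × ℝ`. -/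
def nhdsE (S : BanachScale B) : Filter (B 0 × ℝ) where
  sets := {P | ∃ s, ∀ᶠ p in 𝓝 (0 : B s × ℝ), S.ιE s p ∈ P}
  univ_sets := ⟨0, by simp⟩
  sets_of_superset := by
    rintro P Q ⟨s, hs⟩ hPQ
    exact ⟨s, hs.mono fun p hp => hPQ hp⟩
  inter_sets := by
    rintro P Q ⟨s, hs⟩ ⟨t, ht⟩
    refine ⟨max s t, ?_⟩
    filter_upwards [(S.tendsto_inclE (le_max_left s t)).eventually hs,
      (S.tendsto_inclE (le_max_right s t)).eventually ht] with p h1 h2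
    rw [ιE_inclE] at h1 h2
    exact ⟨h1, h2⟩

theorem eventually_nhdsE (S : BanachScale B) {P : B 0 × ℝ → Prop} :
    (∀ᶠ p in S.nhdsE, P p) ↔ ∃ s, ∀ᶠ p in 𝓝 (0 : B s × ℝ), P (S.ιE s p) := Iff.rfl

theorem eventually_nhdsE_of_rep (S : BanachScale B) {P : B 0 × ℝ → Prop} {s : ℕ}
    (h : ∀ᶠ p in 𝓝 (0 : B s × ℝ), P (S.ιE s p)) : ∀ᶠ p in S.nhdsE, P p := ⟨s, h⟩

/-- If a property holds near the origin of `B s × ℝ`, it does so in all finer spaces. -/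
theorem eventually_ιE_mono (S : BanachScale B) {P : B 0 × ℝ → Prop} {s t : ℕ} (hst : s ≤ t)
    (h : ∀ᶠ p in 𝓝 (0 : B s × ℝ), P (S.ιE s p)) : ∀ᶠ p in 𝓝 (0 : B t × ℝ), P (S.ιE t p) := by
  filter_upwards [(S.tendsto_inclE hst).eventually h] with p hp
  rwa [ιE_inclE] at hp

/-- `f : B s × ℝ → B s'` is of class `C^k` near the origin and represents there `F`. -/
def Rep (S : BanachScale B) (k : ℕ) {s s' : ℕ} (f : B s × ℝ → B s') (F : B 0 × ℝ → B 0) : Prop :=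
  ContDiffAt ℝ k f 0 ∧ ∀ᶠ p in 𝓝 (0 : B s × ℝ), S.ι s' (f p) = F (S.ιE s p)

/-- Germs of almost smooth families of maps. The quantifiers over neighbourhoods of `AlmostSmooth`
and `AlmostSmoothFamily` are absorbed by `ContDiffAt` at the origin, since `k` is finite; the
parameter is a second argument. -/
def Smooth (S : BanachScale B) (F : B 0 × ℝ → B 0) : Prop :=
  ∀ k s' : ℕ, ∃ (s : ℕ) (f : B s × ℝ → B s'), S.Rep k f F

variable {S : BanachScale B} {F G V W A T : B 0 × ℝ → B 0}

theorem Rep.mono {k s s' t : ℕ} {f : B s × ℝ → B s'} (hf : S.Rep k f F) (h : s ≤ t) :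
    S.Rep k (fun p => f (S.inclE h p)) F := by
  refine ⟨?_, ?_⟩
  · have h0 : ContDiffAt ℝ k f (S.inclE h 0) := by simpa using hf.1
    exact h0.comp (0 : B t × ℝ) (S.inclE h).contDiff.contDiffAt
  · filter_upwards [(S.tendsto_inclE h).eventually hf.2] with p hp
    rw [hp, ιE_inclE]

theorem Rep.of_le {k k' s s' : ℕ} {f : B s × ℝ → B s'} (hf : S.Rep k f F) (h : k' ≤ k) :
    S.Rep k' f F :=
  ⟨hf.1.of_le (by exact_mod_cast h), hf.2⟩

theorem Smooth.exists_rep (hF : S.Smooth F) (k s' s₀ : ℕ) :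
    ∃ (s : ℕ) (_ : s₀ ≤ s) (f : B s × ℝ → B s'), S.Rep k f F := by
  obtain ⟨s, f, hf⟩ := hF k s'
  exact ⟨max s s₀, le_max_right _ _, _, hf.mono (le_max_left s s₀)⟩

theorem Smooth.exists_rep₂ (hF : S.Smooth F) (hG : S.Smooth G) (k s' s₀ : ℕ) :
    ∃ (s : ℕ) (_ : s₀ ≤ s) (f g : B s × ℝ → B s'), S.Rep k f F ∧ S.Rep k g G := by
  obtain ⟨s, hs, f, hf⟩ := hF.exists_rep k s' s₀
  obtain ⟨t, ht, g, hg⟩ := hG.exists_rep k s' s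
  exact ⟨t, hs.trans ht, _, g, hf.mono ht, hg⟩

theorem Smooth.add (hF : S.Smooth F) (hG : S.Smooth G) : S.Smooth (fun p => F p + G p) := by
  intro k s'
  obtain ⟨s, -, f, g, hf, hg⟩ := hF.exists_rep₂ hG k s' 0
  refine ⟨s, fun p => f p + g p, hf.1.add hg.1, ?_⟩
  filter_upwards [hf.2, hg.2] with p h1 h2
  rw [map_add, h1, h2]

theorem Smooth.smul (hF : S.Smooth F) {φ : ℝ → ℝ} (hφ : ∀ k : ℕ, ContDiff ℝ k φ) :
    S.Smooth (fun p => φ p.2 • F p) := by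
  intro k s'
  obtain ⟨s, f, hf⟩ := hF k s'
  refine ⟨s, fun p => φ p.2 • f p, ((hφ k).comp contDiff_snd).contDiffAt.smul hf.1, ?_⟩
  filter_upwards [hf.2] with p h1
  rw [map_smul, h1, ιE_apply]

theorem Smooth.const_smul (hF : S.Smooth F) (c : ℝ) : S.Smooth (fun p => c • F p) :=
  hF.smul (φ := fun _ => c) fun _ => contDiff_const

theorem Smooth.pow_smul (hF : S.Smooth F) (n : ℕ) : S.Smooth (fun p => p.2 ^ n • F p) :=
  hF.smul (φ := fun e => e ^ n) fun _ => contDiff_id.pow n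

theorem Smooth.neg (hF : S.Smooth F) : S.Smooth (fun p => -F p) := by
  simpa using hF.const_smul (-1)

theorem Smooth.sub (hF : S.Smooth F) (hG : S.Smooth G) : S.Smooth (fun p => F p - G p) := by
  simpa [sub_eq_add_neg] using hF.add hG.neg

theorem smooth_fst (S : BanachScale B) : S.Smooth (fun p => p.1) := fun _ s' =>
  ⟨s', fun p => p.1, contDiff_fst.contDiffAt, Eventually.of_forall fun _ => rfl⟩

theorem smooth_zero (S : BanachScale B) : S.Smooth (fun _ => 0) := fun _ s' =>
  ⟨s', fun _ => 0, contDiffAt_const, by simp⟩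

theorem Smooth.sum {F : ℕ → B 0 × ℝ → B 0} (hF : ∀ l, S.Smooth (F l)) (n : ℕ) :
    S.Smooth (fun p => ∑ l ∈ Finset.range n, F l p) := by
  induction n with
  | zero => simpa using S.smooth_zero
  | succ n ih => simpa [Finset.sum_range_succ] using ih.add (hF n)

/-! ### Derivatives along vector fields -/

/-- The derivative of `F` at `p` in the direction `(V p, c)`, where `c` is the velocity of the
parameter. -/
def along (F V : B 0 × ℝ → B 0) (c : ℝ) (p : B 0 × ℝ) : B 0 := lineDeriv ℝ F p (V p, c)

theorem hasLineDerivAt_of_eventually_eq {s s' : ℕ} {f : B s × ℝ → B s'} {p : B s × ℝ}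
    (hd : DifferentiableAt ℝ f p) (he : ∀ᶠ q in 𝓝 p, S.ι s' (f q) = F (S.ιE s q))
    (v : B s × ℝ) : HasLineDerivAt ℝ F (S.ι s' (fderiv ℝ f p v)) (S.ιE s p) (S.ιE s v) := by
  have h1 : HasLineDerivAt ℝ (fun q => S.ι s' (f q)) (S.ι s' (fderiv ℝ f p v)) p v :=
    ((S.ι s').hasFDerivAt.comp p hd.hasFDerivAt).hasLineDerivAt v
  have h2 : ∀ᶠ t : ℝ in 𝓝 0, S.ι s' (f (p + t • v)) = F (S.ιE s p + t • S.ιE s v) := by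
    have : Tendsto (fun t : ℝ => p + t • v) (𝓝 0) (𝓝 p) := by
      have : Continuous fun t : ℝ => p + t • v := by fun_prop
      simpa using this.tendsto 0
    filter_upwards [this.eventually he] with t ht
    rw [ht, map_add, map_smul]
  exact HasDerivAt.congr_of_eventuallyEq h1 (h2.mono fun t ht => ht.symm)

/-- Near the origin, directional derivatives of the representative represent those of `F`. -/
theorem Rep.eventually_hasLineDerivAt {k s s' : ℕ} {f : B s × ℝ → B s'} (hf : S.Rep (k + 1) f F) :
    ∀ᶠ p in 𝓝 (0 : B s × ℝ), ContDiffAt ℝ (k + 1) f p ∧ ∀ v : B s × ℝ,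
      HasLineDerivAt ℝ F (S.ι s' (fderiv ℝ f p v)) (S.ιE s p) (S.ιE s v) := by
  filter_upwards [hf.1.eventually (by simp), hf.2.eventually_nhds] with p h1 h2
  exact ⟨by exact_mod_cast h1, hasLineDerivAt_of_eventually_eq (h1.differentiableAt (by simp)) h2⟩

/-- A family with `T 0 = 0` is represented by maps which preserve the origin; `T` need not vanish
at `(0, ε)`. -/
theorem Rep.map_zero {k s s' : ℕ} {f : B s × ℝ → B s'} (hf : S.Rep k f F) (h0 : F 0 = 0) :
    f 0 = 0 := by
  have := hf.2.self_of_nhds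
  rw [_root_.map_zero, h0] at this
  exact (map_eq_zero_iff _ (S.ι_injective s')).1 this

theorem Rep.tendsto {k s s' : ℕ} {f : B s × ℝ → B s'} (hf : S.Rep k f F) (h0 : F 0 = 0) :
    Tendsto (fun p => (f p, p.2)) (𝓝 0) (𝓝 (0 : B s' × ℝ)) := by
  have h1 : ContinuousAt (fun p : B s × ℝ => (f p, p.2)) 0 :=
    hf.1.continuousAt.prodMk continuous_snd.continuousAt
  have h2 := h1.tendsto
  rw [hf.map_zero h0] at h2
  exact h2

theorem Rep.comp {k s s' t : ℕ} {f : B s × ℝ → B s'} {τ : B t × ℝ → B s} (hf : S.Rep k f F)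
    (hτ : S.Rep k τ T) (h0 : T 0 = 0) :
    S.Rep k (fun p => f (τ p, p.2)) (fun p => F (T p, p.2)) := by
  refine ⟨?_, ?_⟩
  · have h1 : ContDiffAt ℝ k f (τ 0, (0 : B t × ℝ).2) := by
      rw [hτ.map_zero h0]
      exact hf.1
    exact h1.comp (0 : B t × ℝ) (hτ.1.prodMk contDiff_snd.contDiffAt)
  · filter_upwards [hτ.2, (hτ.tendsto h0).eventually hf.2] with p h1 h2
    rw [h2, ← h1, ιE_apply, ιE_apply]

theorem Smooth.comp (hF : S.Smooth F) (hT : S.Smooth T) (h0 : T 0 = 0) :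
    S.Smooth (fun p => F (T p, p.2)) := by
  intro k s'
  obtain ⟨s, f, hf⟩ := hF k s'
  obtain ⟨t, τ, hτ⟩ := hT k s
  exact ⟨t, _, hf.comp hτ h0⟩

theorem Rep.lineDeriv_comp {k s s' t : ℕ} {f : B s × ℝ → B s'} {τ a : B t × ℝ → B s}
    (hf : S.Rep (k + 1) f F) (hτ : S.Rep k τ T) (h0 : T 0 = 0) (ha : S.Rep k a A) (c : ℝ) :
    S.Rep k (fun p => fderiv ℝ f (τ p, p.2) (a p, c))
      (fun p => lineDeriv ℝ F (T p, p.2) (A p, c)) := by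
  refine ⟨?_, ?_⟩
  · have h1 : ContDiffAt ℝ k (fderiv ℝ f) (τ 0, (0 : B t × ℝ).2) := by
      rw [hτ.map_zero h0]
      exact hf.1.fderiv_right (by norm_cast)
    exact (h1.comp (0 : B t × ℝ) (hτ.1.prodMk contDiff_snd.contDiffAt)).clm_apply
      (ha.1.prodMk contDiffAt_const)
  · filter_upwards [hτ.2, ha.2, (hτ.tendsto h0).eventually hf.eventually_hasLineDerivAt]
      with p h1 h2 h3
    rw [← (h3.2 (a p, c)).lineDeriv, ιE_apply, ιE_apply, ← h1, ← h2]
    rfl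

theorem Smooth.lineDeriv_comp (hF : S.Smooth F) (hT : S.Smooth T) (h0 : T 0 = 0)
    (hA : S.Smooth A) (c : ℝ) : S.Smooth (fun p => lineDeriv ℝ F (T p, p.2) (A p, c)) := by
  intro k s'
  obtain ⟨s, f, hf⟩ := hF (k + 1) s'
  obtain ⟨t, -, τ, a, hτ, ha⟩ := hT.exists_rep₂ hA k s 0
  exact ⟨t, _, hf.lineDeriv_comp hτ h0 ha c⟩

theorem Rep.along {k s s' t : ℕ} {f : B s × ℝ → B s'} {v : B t × ℝ → B s}
    (hf : S.Rep (k + 1) f F) (hv : S.Rep k v V) (h : s ≤ t) (c : ℝ) :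
    S.Rep k (fun p => fderiv ℝ f (S.inclE h p) (v p, c)) (along F V c) := by
  have h1 : S.Rep k (fun p : B t × ℝ => S.incl h p.1) (fun p => p.1) :=
    ⟨((S.incl h).contDiff.comp contDiff_fst).contDiffAt,
      Eventually.of_forall fun p => by rw [ι_incl, ιE_apply]⟩
  exact hf.lineDeriv_comp h1 rfl hv c

theorem Smooth.along (hF : S.Smooth F) (hV : S.Smooth V) (c : ℝ) : S.Smooth (along F V c) :=
  hF.lineDeriv_comp S.smooth_fst rfl hV c

theorem Smooth.hasLineDerivAt_comp (hF : S.Smooth F) (hT : S.Smooth T) (h0 : T 0 = 0)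
    (hA : S.Smooth A) (c : ℝ) : ∀ᶠ p in S.nhdsE,
      HasLineDerivAt ℝ F (lineDeriv ℝ F (T p, p.2) (A p, c)) (T p, p.2) (A p, c) := by
  obtain ⟨s, f, hf⟩ := hF 1 0
  obtain ⟨t, -, τ, a, hτ, ha⟩ := hT.exists_rep₂ hA 1 s 0
  refine S.eventually_nhdsE_of_rep (s := t) ?_
  filter_upwards [hτ.2, ha.2,
    (hτ.tendsto h0).eventually (hf.eventually_hasLineDerivAt (k := 0))] with p h1 h2 h3
  have h4 := h3.2 (a p, c)
  rw [← h1, ← h2]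
  have h5 := h4.lineDeriv
  simp only [ιE_apply] at h4 h5 ⊢
  rwa [h5]

theorem Smooth.hasLineDerivAt (hF : S.Smooth F) (hV : S.Smooth V) (c : ℝ) :
    ∀ᶠ p in S.nhdsE, HasLineDerivAt ℝ F (BanachScale.along F V c p) p (V p, c) :=
  hF.hasLineDerivAt_comp S.smooth_fst rfl hV c

/-- Derivatives along smooth fields depend only on the germ of the function. -/
theorem along_congr (hV : S.Smooth V) (h : F =ᶠ[S.nhdsE] G) (c : ℝ) :
    along F V c =ᶠ[S.nhdsE] along G V c := by
  obtain ⟨s, hs⟩ := S.eventually_nhdsE.1 h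
  obtain ⟨t, ht, v, hv⟩ := hV.exists_rep 0 s s
  refine S.eventually_nhdsE_of_rep (s := t) ?_
  filter_upwards [hv.2, (S.tendsto_inclE ht).eventually hs.eventually_nhds] with p h1 h2
  have h3 : Tendsto (fun r : ℝ => S.inclE ht p + r • (v p, c)) (𝓝 0) (𝓝 (S.inclE ht p)) := by
    have : Continuous fun r : ℝ => S.inclE ht p + r • (v p, c) := by fun_prop
    simpa using this.tendsto 0
  refine Filter.EventuallyEq.deriv_eq ?_
  filter_upwards [h3.eventually h2] with r hr
  rw [map_add, map_smul, ιE_inclE, ιE_apply S s (v p, c), h1] at hr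
  exact hr

theorem along_congr_dir (h : V =ᶠ[S.nhdsE] W) (c : ℝ) :
    along F V c =ᶠ[S.nhdsE] along F W c := by
  filter_upwards [h] with p hp
  simp only [along, hp]

theorem Smooth.along_add (hF : S.Smooth F) (hV : S.Smooth V) (hW : S.Smooth W) (c d : ℝ) :
    BanachScale.along F (fun p => V p + W p) (c + d) =ᶠ[S.nhdsE]
      fun p => BanachScale.along F V c p + BanachScale.along F W d p := by
  obtain ⟨s, f, hf⟩ := hF 1 0
  obtain ⟨t, ht, v, hv⟩ := hV.exists_rep 0 s s
  obtain ⟨u, hu, w, hw⟩ := hW.exists_rep 0 s t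
  have hv' := hv.mono hu
  refine S.eventually_nhdsE_of_rep (s := u) ?_
  filter_upwards [hv'.2, hw.2, (S.tendsto_inclE (ht.trans hu)).eventually
    (hf.eventually_hasLineDerivAt (k := 0))] with p h1 h2 h3
  have key : ∀ (x : B s) (e : ℝ), lineDeriv ℝ F (S.ιE u p) (S.ι s x, e)
      = S.ι 0 (fderiv ℝ f (S.inclE (ht.trans hu) p) (x, e)) := by
    intro x e
    have := (h3.2 (x, e)).lineDeriv
    rwa [ιE_inclE] at this
  simp only [BanachScale.along]
  rw [← h1, ← h2, ← map_add, key, key, key, ← map_add, ← map_add, Prod.mk_add_mk]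

theorem along_smul_dir (F V : B 0 × ℝ → B 0) (φ : ℝ → ℝ) (p : B 0 × ℝ) :
    along F (fun p => φ p.2 • V p) 0 p = φ p.2 • along F V 0 p := by
  simp only [along]
  rw [← lineDeriv_smul]
  simp

theorem along_smul (F V : B 0 × ℝ → B 0) (φ : ℝ → ℝ) (p : B 0 × ℝ) :
    along (fun p => φ p.2 • F p) V 0 p = φ p.2 • along F V 0 p := by
  simp only [along, lineDeriv, Prod.smul_mk, smul_zero, Prod.snd_add, add_zero]
  exact deriv_const_smul_field _ _

theorem Smooth.along_sum_dir (hF : S.Smooth F) {V : ℕ → B 0 × ℝ → B 0}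
    (hV : ∀ l, S.Smooth (V l)) (n : ℕ) :
    BanachScale.along F (fun p => ∑ l ∈ Finset.range n, V l p) 0 =ᶠ[S.nhdsE]
      fun p => ∑ l ∈ Finset.range n, BanachScale.along F (V l) 0 p := by
  induction n with
  | zero =>
    refine Eventually.of_forall fun p => ?_
    simp only [BanachScale.along, Finset.range_zero, Finset.sum_empty]
    exact lineDeriv_zero
  | succ n ih =>
    have h := hF.along_add (Smooth.sum hV n) (hV n) 0 0
    simp only [Finset.sum_range_succ, add_zero] at h ⊢
    filter_upwards [ih, h] with p h1 h2
    rw [h2, h1]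

theorem Smooth.along_sub (hF : S.Smooth F) (hG : S.Smooth G) (hV : S.Smooth V) (c : ℝ) :
    BanachScale.along (fun p => F p - G p) V c =ᶠ[S.nhdsE]
      fun p => BanachScale.along F V c p - BanachScale.along G V c p := by
  filter_upwards [hF.hasLineDerivAt hV c, hG.hasLineDerivAt hV c] with p h1 h2
  exact (HasDerivAt.sub h1 h2).deriv

/-- The chain rule for the composition with a family of maps `T` with `T 0 = 0`. -/
theorem Smooth.along_comp (hF : S.Smooth F) (hT : S.Smooth T) (h0 : T 0 = 0) (hV : S.Smooth V)
    (c : ℝ) : BanachScale.along (fun p => F (T p, p.2)) V c =ᶠ[S.nhdsE]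
      fun p => lineDeriv ℝ F (T p, p.2) (BanachScale.along T V c p, c) := by
  obtain ⟨s, f, hf⟩ := hF 1 0
  obtain ⟨t, τ, hτ⟩ := hT 1 s
  obtain ⟨u, hu, v, hv⟩ := hV.exists_rep 1 t t
  have hfτ := (hf.comp hτ h0).along (k := 0) (hv.of_le zero_le_one) hu c
  have hτ' := hτ.along (k := 0) (hv.of_le zero_le_one) hu c
  refine S.eventually_nhdsE_of_rep (s := u) ?_
  filter_upwards [hfτ.2, hτ'.2, (S.tendsto_inclE hu).eventually
    ((hτ.tendsto h0).eventually (hf.eventually_hasLineDerivAt (k := 0))),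
    (S.tendsto_inclE hu).eventually (hτ.eventually_hasLineDerivAt (k := 0)),
    (hτ.mono hu).2] with p h1 h2 h3 h4 h5
  have h6 := (h3.2 (fderiv ℝ τ (S.inclE hu p) (v p, c), c)).lineDeriv
  rw [ιE_apply, ιE_apply] at h6
  simp only [h5, h2] at h6
  rw [← h1]
  refine Eq.trans ?_ h6.symm
  congr 1
  have d1 : HasFDerivAt (fun q => (τ q, q.2)) _ (S.inclE hu p) :=
    ((h4.1.differentiableAt (by simp)).hasFDerivAt).prodMk hasFDerivAt_snd
  have d2 := HasFDerivAt.comp (g := f) (S.inclE hu p)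
    (h3.1.differentiableAt (by simp)).hasFDerivAt d1
  have := d2.fderiv
  simp only [Function.comp_def] at this
  rw [this]
  rfl

/-- The commutator of two derivations `∂_(V, c)` and `∂_(W, d)` is the derivation along the Lie
bracket of the fields; this is the symmetry of second derivatives. -/
theorem Smooth.along_along (hF : S.Smooth F) (hV : S.Smooth V) (hW : S.Smooth W) (c d : ℝ) :
    BanachScale.along (BanachScale.along F W d) V c =ᶠ[S.nhdsE] fun p =>
      BanachScale.along (BanachScale.along F V c) W d p
        + BanachScale.along F
          (fun p => BanachScale.along W V c p - BanachScale.along V W d p) 0 p := by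
  obtain ⟨s, f, hf⟩ := hF 2 0
  obtain ⟨t', ht, v2, w, hv, hw⟩ := hV.exists_rep₂ hW 1 s s
  obtain ⟨u', hu, v3, w', hv', hw'⟩ := hV.exists_rep₂ hW 1 t' t'
  have rW := hf.along hw ht d
  have rV := hf.along hv ht c
  have rWV := rW.along (k := 0) (hv'.of_le zero_le_one) hu c
  have rVW := rV.along (k := 0) (hw'.of_le zero_le_one) hu d
  have rwv := hw.along (k := 0) (hv'.of_le zero_le_one) hu c
  have rvw := hv.along (k := 0) (hw'.of_le zero_le_one) hu d
  refine S.eventually_nhdsE_of_rep (s := u') ?_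
  filter_upwards [rWV.2, rVW.2, rwv.2, rvw.2,
    (S.tendsto_inclE hu).eventually (hw.eventually_hasLineDerivAt (k := 0)),
    (S.tendsto_inclE hu).eventually (hv.eventually_hasLineDerivAt (k := 0)),
    (S.tendsto_inclE (ht.trans hu)).eventually (hf.eventually_hasLineDerivAt (k := 1)),
    hv'.2, hw'.2, (hv.mono hu).2, (hw.mono hu).2]
    with p e1 e2 e3 e4 dw dv df e5 e6 e7 e8
  set q := S.inclE hu p with hq
  have hq' : S.inclE ht q = S.inclE (ht.trans hu) p := by
    simp only [hq, inclE_apply, S.incl_trans]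
  rw [← hq'] at df
  have dff : HasFDerivAt (fderiv ℝ f) (fderiv ℝ (fderiv ℝ f) (S.inclE ht q)) (S.inclE ht q) :=
    ((df.1.fderiv_right (m := 1) (by norm_cast)).differentiableAt (by simp)).hasFDerivAt
  have symm : IsSymmSndFDerivAt ℝ f (S.inclE ht q) :=
    ContDiffAt.isSymmSndFDerivAt (n := 2) (by exact_mod_cast df.1) (by simp)
  have main : ∀ (a : B t' × ℝ → B s) (e : ℝ), DifferentiableAt ℝ a q → ∀ y : B t' × ℝ,
      fderiv ℝ (fun p => fderiv ℝ f (S.inclE ht p) (a p, e)) q y =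
        fderiv ℝ (fderiv ℝ f) (S.inclE ht q) (S.inclE ht y) (a q, e)
          + fderiv ℝ f (S.inclE ht q) (fderiv ℝ a q y, 0) := by
    intro a e ha y
    have d1 : HasFDerivAt (fun p => (a p, e)) ((fderiv ℝ a q).prod 0) q :=
      ha.hasFDerivAt.prodMk (hasFDerivAt_const e q)
    have d2 := (dff.comp q (S.inclE ht).hasFDerivAt).clm_apply d1
    have d3 := d2.fderiv
    simp only [Function.comp_def] at d3
    rw [d3]
    simp [add_comm]
  have i1 : S.inclE ht (v3 p, c) = (v2 q, c) := by
    rw [inclE_apply]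
    refine Prod.ext (S.ι_injective s ?_) rfl
    change S.ι s (S.incl ht (v3 p)) = S.ι s (v2 q)
    rw [ι_incl, e5, e7]
  have i2 : S.inclE ht (w' p, d) = (w q, d) := by
    rw [inclE_apply]
    refine Prod.ext (S.ι_injective s ?_) rfl
    change S.ι s (S.incl ht (w' p)) = S.ι s (w q)
    rw [ι_incl, e6, e8]
  have e9 : BanachScale.along F
      (fun p => BanachScale.along W V c p - BanachScale.along V W d p) 0 (S.ιE u' p)
      = S.ι 0 (fderiv ℝ f (S.inclE ht q)
        (fderiv ℝ w q (v3 p, c) - fderiv ℝ v2 q (w' p, d), 0)) := by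
    simp only [BanachScale.along]
    simp only [BanachScale.along] at e3 e4
    rw [← e3, ← e4, ← map_sub]
    have h1 := (df.2 (fderiv ℝ w q (v3 p, c) - fderiv ℝ v2 q (w' p, d), 0)).lineDeriv
    rwa [hq', ιE_inclE, ← hq', ιE_apply S s (_, _)] at h1
  rw [e9, ← e1, ← e2, main w d (dw.1.differentiableAt (by simp)),
    main v2 c (dv.1.differentiableAt (by simp)), i1, i2, symm.eq (v2 q, c) (w q, d), ← map_add]
  congr 1
  have : (fderiv ℝ w q (v3 p, c) - fderiv ℝ v2 q (w' p, d), (0 : ℝ))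
      = (fderiv ℝ w q (v3 p, c), 0) - (fderiv ℝ v2 q (w' p, d), 0) := by simp
  rw [this, map_sub]
  abel

end BanachScale

/-! ### Division by powers of the parameter -/

section ParametricIntegral

variable {P F : Type u} [NormedAddCommGroup P] [NormedSpace ℝ P] [NormedAddCommGroup F]
  [NormedSpace ℝ F]

theorem ContDiffOn.hasFDerivAt_integral_param {f : P × ℝ → F} {U : Set P} (hU : IsOpen U)
    {I : Set ℝ} (hI : IsOpen I) (h01 : Icc 0 1 ⊆ I) (hf : ContDiffOn ℝ 1 f (U ×ˢ I)) {p : P}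
    (hp : p ∈ U) :
    HasFDerivAt (fun p => ∫ τ in (0 : ℝ)..1, f (p, τ))
      (∫ τ in (0 : ℝ)..1, (fderiv ℝ f (p, τ)).comp (ContinuousLinearMap.inl ℝ P ℝ)) p := by
  have hUI : IsOpen (U ×ˢ I) := hU.prod hI
  have hc : ContinuousOn (fderiv ℝ f) (U ×ˢ I) := hf.continuousOn_fderiv_of_isOpen hUI le_rfl
  have huIcc : uIcc (0 : ℝ) 1 ⊆ I := by rwa [uIcc_of_le zero_le_one]
  have hIoc : uIoc (0 : ℝ) 1 ⊆ I := uIoc_subset_uIcc.trans huIcc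
  have slice : ∀ q ∈ U, ContinuousOn (fun τ : ℝ => (q, τ)) (uIcc 0 1) ∧
      MapsTo (fun τ : ℝ => (q, τ)) (uIcc 0 1) (U ×ˢ I) := fun q hq =>
    ⟨by fun_prop, fun τ hτ => ⟨hq, huIcc hτ⟩⟩
  have cF : ∀ q ∈ U, ContinuousOn (fun τ => f (q, τ)) (uIcc 0 1) := fun q hq =>
    hf.continuousOn.comp (slice q hq).1 (slice q hq).2
  have cF' : ContinuousOn (fun τ => (fderiv ℝ f (p, τ)).comp (ContinuousLinearMap.inl ℝ P ℝ))
      (uIcc 0 1) :=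
    (hc.comp (slice p hp).1 (slice p hp).2).clm_comp continuousOn_const
  -- a bound on the derivative which is uniform on a neighbourhood of `{p} × [0, 1]`
  obtain ⟨M, hM⟩ := (isCompact_Icc (a := (0 : ℝ)) (b := 1)).exists_bound_of_continuousOn
    (uIcc_of_le (zero_le_one' ℝ) ▸ hc.comp (slice p hp).1 (slice p hp).2)
  have hb : ∀ᶠ q in 𝓝 p, ∀ τ ∈ Icc (0 : ℝ) 1, (q, τ) ∈ U ×ˢ I ∧ ‖fderiv ℝ f (q, τ)‖ < M + 1 := by
    refine isCompact_Icc.eventually_forall_of_forall_eventually fun τ hτ => ?_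
    have hmem : (p, τ) ∈ U ×ˢ I := ⟨hp, h01 hτ⟩
    refine (hUI.eventually_mem hmem).and ?_
    refine (hc.continuousAt (hUI.mem_nhds hmem)).norm.eventually_lt continuousAt_const ?_
    exact lt_of_le_of_lt (hM τ hτ) (lt_add_one M)
  refine intervalIntegral.hasFDerivAt_integral_of_dominated_of_fderiv_le
    (F' := fun q τ => (fderiv ℝ f (q, τ)).comp (ContinuousLinearMap.inl ℝ P ℝ))
    (bound := fun _ => (M + 1) * ‖ContinuousLinearMap.inl ℝ P ℝ‖) hb ?_ ?_ ?_ ?_ ?_ ?_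
  · filter_upwards [hU.mem_nhds hp] with q hq
    exact ((cF q hq).mono uIoc_subset_uIcc).aestronglyMeasurable measurableSet_uIoc
  · exact (cF p hp).intervalIntegrable
  · exact (cF'.mono uIoc_subset_uIcc).aestronglyMeasurable measurableSet_uIoc
  · refine Eventually.of_forall fun τ hτ q hq => ?_
    have := (hq τ (by simpa using uIoc_subset_uIcc hτ)).2.le
    exact (ContinuousLinearMap.opNorm_comp_le _ _).trans (by gcongr)
  · exact intervalIntegrable_const
  · refine Eventually.of_forall fun τ hτ q hq => ?_
    have hmem := (hq τ (by simpa using uIoc_subset_uIcc hτ)).1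
    have hd : HasFDerivAt f (fderiv ℝ f (q, τ)) (q, τ) :=
      ((hf.contDiffAt (hUI.mem_nhds hmem)).differentiableAt (by simp)).hasFDerivAt
    exact hd.comp q (hasFDerivAt_prodMk_left q τ)

/-- An integral over `[0, 1]` depends smoothly on the parameters; no attempt is made to avoid the
loss of one derivative. -/
theorem ContDiffOn.integral_param (k : ℕ) {f : P × ℝ → F} {U : Set P} (hU : IsOpen U)
    {I : Set ℝ} (hI : IsOpen I) (h01 : Icc 0 1 ⊆ I) (hf : ContDiffOn ℝ (k + 1) f (U ×ˢ I)) :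
    ContDiffOn ℝ k (fun p => ∫ τ in (0 : ℝ)..1, f (p, τ)) U := by
  induction k generalizing F with
  | zero =>
    refine contDiffOn_zero.2 fun p hp => ?_
    exact (ContDiffOn.hasFDerivAt_integral_param hU hI h01 (by simpa using hf)
      hp).continuousAt.continuousWithinAt
  | succ k ih =>
    have hd := fun p (hp : p ∈ U) => ContDiffOn.hasFDerivAt_integral_param hU hI h01
      (hf.of_le (by exact_mod_cast Nat.succ_le_succ (Nat.zero_le _))) hp
    push_cast
    rw [contDiffOn_succ_iff_fderiv_of_isOpen hU]
    refine ⟨fun p hp => (hd p hp).differentiableAt.differentiableWithinAt, by simp, ?_⟩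
    refine ContDiffOn.congr ?_ fun p hp => (hd p hp).fderiv
    refine ih (f := fun q => (fderiv ℝ f q).comp (ContinuousLinearMap.inl ℝ P ℝ)) ?_
    exact (hf.fderiv_of_isOpen (hU.prod hI) (by norm_cast)).clm_comp contDiffOn_const

end ParametricIntegral

namespace BanachScale

variable {B : ℕ → Type u} [∀ s, NormedAddCommGroup (B s)] [∀ s, NormedSpace ℝ (B s)]
  {S : BanachScale B} {F G V W A T : B 0 × ℝ → B 0}

theorem Rep.exists_ball {k s s' : ℕ} {f : B s × ℝ → B s'} (hf : S.Rep k f F) :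
    ∃ δ > 0, ContDiffOn ℝ k f (Metric.ball 0 δ) ∧
      ∀ p ∈ Metric.ball (0 : B s × ℝ) δ, S.ι s' (f p) = F (S.ιE s p) := by
  obtain ⟨δ, hδ, h⟩ := Metric.eventually_nhds_iff_ball.1
    ((hf.1.eventually (by simp)).and hf.2)
  exact ⟨δ, hδ, fun p hp => (h p hp).1.contDiffWithinAt, fun p hp => (h p hp).2⟩

theorem _root_.Metric.scale_snd_mem_ball {Z : Type*} [SeminormedAddCommGroup Z] {δ τ : ℝ}
    {p : Z × ℝ} (hp : p ∈ Metric.ball (0 : Z × ℝ) δ) (hτ : |τ| ≤ 1) :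
    (p.1, τ * p.2) ∈ Metric.ball (0 : Z × ℝ) δ := by
  rw [mem_ball_zero_iff, Prod.norm_def, max_lt_iff] at hp ⊢
  refine ⟨hp.1, lt_of_le_of_lt ?_ hp.2⟩
  rw [norm_mul]
  exact mul_le_of_le_one_left (norm_nonneg _) hτ

/-- Averages in the parameter of a smooth family form a smooth family. -/
theorem Smooth.integral [∀ s, CompleteSpace (B s)] (hF : S.Smooth F) (n : ℕ) :
    S.Smooth (fun p => ∫ τ in (0 : ℝ)..1, τ ^ n • F (p.1, τ * p.2)) := by
  intro k s'
  obtain ⟨s, f, hf⟩ := hF (k + 1) s'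
  obtain ⟨δ, hδ, hfs, hfe⟩ := hf.exists_ball
  have hmaps : MapsTo (fun q : (B s × ℝ) × ℝ => (q.1.1, q.2 * q.1.2))
      (Metric.ball 0 (δ / 2) ×ˢ Ioo (-2) 2) (Metric.ball 0 δ) := by
    rintro ⟨⟨z, e⟩, τ⟩ ⟨h1, h2⟩
    rw [mem_ball_zero_iff, Prod.norm_def, max_lt_iff] at h1 ⊢
    refine ⟨h1.1.trans (half_lt_self hδ), ?_⟩
    have h3 : |τ| < 2 := abs_lt.2 h2
    have h4 : ‖e‖ < δ / 2 := h1.2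
    calc ‖τ * e‖ = |τ| * ‖e‖ := norm_mul _ _
      _ ≤ 2 * ‖e‖ := by gcongr
      _ < δ := by linarith
  have hint : ContDiffOn ℝ (k + 1) (fun q : (B s × ℝ) × ℝ => q.2 ^ n • f (q.1.1, q.2 * q.1.2))
      (Metric.ball 0 (δ / 2) ×ˢ Ioo (-2) 2) := by
    refine (contDiff_snd.pow n).contDiffOn.smul ?_
    refine ContDiffOn.comp (by exact_mod_cast hfs) (ContDiff.contDiffOn ?_) hmaps
    fun_prop
  have h01 : Icc (0 : ℝ) 1 ⊆ Ioo (-2) 2 := Icc_subset_Ioo (by norm_num) (by norm_num)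
  have hI := ContDiffOn.integral_param k Metric.isOpen_ball isOpen_Ioo h01 hint
  have h0 := Metric.ball_mem_nhds (0 : B s × ℝ) (half_pos hδ)
  refine ⟨s, _, hI.contDiffAt h0, ?_⟩
  filter_upwards [h0] with p hp
  rw [← ContinuousLinearMap.intervalIntegral_comp_comm]
  · refine intervalIntegral.integral_congr fun τ hτ => ?_
    rw [uIcc_of_le zero_le_one] at hτ
    have := hfe _ (hmaps (x := (p, τ)) ⟨hp, h01 hτ⟩)
    simp only [ιE_apply] at this
    simp only [map_smul, this, ιE_apply]
  · refine ContinuousOn.intervalIntegrable ?_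
    rw [uIcc_of_le zero_le_one]
    exact hint.continuousOn.comp (f := fun τ : ℝ => (p, τ)) (by fun_prop)
      fun τ hτ => ⟨hp, h01 hτ⟩

/-- Hadamard's lemma: a smooth family which vanishes for `ε = 0` and whose derivative in `ε` is
divisible by `ε ^ n` is divisible by `ε ^ (n + 1)`. -/
theorem Smooth.exists_eq_pow_smul [∀ s, CompleteSpace (B s)] (hF : S.Smooth F) (hG : S.Smooth G)
    (n : ℕ) (h0 : ∀ᶠ p in S.nhdsE, F (p.1, 0) = 0)
    (hd : BanachScale.along F (fun _ => 0) 1 =ᶠ[S.nhdsE] fun p => p.2 ^ n • G p) :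
    ∃ Q, S.Smooth Q ∧ F =ᶠ[S.nhdsE] fun p => p.2 ^ (n + 1) • Q p := by
  refine ⟨_, hG.integral n, ?_⟩
  have h1 : ∀ᶠ p in S.nhdsE, F (p.1, 0) = 0 ∧
      HasLineDerivAt ℝ F (p.2 ^ n • G p) p (0, 1) := by
    filter_upwards [h0, hd, hF.hasLineDerivAt S.smooth_zero 1] with p h1 h2 h3
    exact ⟨h1, h2 ▸ h3⟩
  obtain ⟨s, hs⟩ := S.eventually_nhdsE.1 h1
  obtain ⟨t, ht, g, hg⟩ := hG.exists_rep 0 0 s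
  obtain ⟨δ', hδ', hgc, hge⟩ := hg.exists_ball
  obtain ⟨δ, hδ, h⟩ := Metric.eventually_nhds_iff_ball.1 (S.eventually_ιE_mono
    (P := fun p => F (p.1, 0) = 0 ∧ HasLineDerivAt ℝ F (p.2 ^ n • G p) p (0, 1)) ht hs)
  refine S.eventually_nhdsE_of_rep (s := t) ?_
  filter_upwards [Metric.ball_mem_nhds _ hδ, Metric.ball_mem_nhds _ hδ'] with p hp hp'
  have habs : ∀ τ ∈ uIcc (0 : ℝ) 1, |τ| ≤ 1 := by
    intro τ hτ
    rw [uIcc_of_le zero_le_one] at hτ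
    rw [abs_of_nonneg hτ.1]
    exact hτ.2
  have hder : ∀ τ ∈ uIcc (0 : ℝ) 1, HasDerivAt (fun τ => F (S.ι t p.1, τ * p.2))
      (p.2 ^ (n + 1) • τ ^ n • G (S.ι t p.1, τ * p.2)) τ := by
    intro τ hτ
    have h2 := (h _ (Metric.scale_snd_mem_ball hp (habs τ hτ))).2
    simp only [HasLineDerivAt, ιE_apply, Prod.smul_mk, Prod.mk_add_mk, smul_zero, add_zero,
      smul_eq_mul, mul_one] at h2
    have h3 : HasDerivAt (fun e : ℝ => F (S.ι t p.1, e))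
        ((τ * p.2) ^ n • G (S.ι t p.1, τ * p.2)) (τ * p.2) := by
      rw [← add_neg_cancel (τ * p.2)] at h2
      simpa using h2.comp_add_const (τ * p.2) (-(τ * p.2))
    have h4 : HasDerivAt (fun τ => F (S.ι t p.1, τ * p.2)) _ τ :=
      HasDerivAt.scomp (g₁ := fun e : ℝ => F (S.ι t p.1, e)) τ h3
        ((hasDerivAt_id τ).mul_const p.2)
    refine h4.congr_deriv ?_
    rw [smul_smul, smul_smul]
    congr 1
    ring
  have hcont : ContinuousOn (fun τ : ℝ => p.2 ^ (n + 1) • τ ^ n • G (S.ι t p.1, τ * p.2))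
      (uIcc 0 1) := by
    have h2 : ContinuousOn (fun τ : ℝ => g (p.1, τ * p.2)) (uIcc 0 1) :=
      hgc.continuousOn.comp (f := fun τ : ℝ => (p.1, τ * p.2)) (by fun_prop)
        fun τ hτ => Metric.scale_snd_mem_ball hp' (habs τ hτ)
    have h3 : ContinuousOn (fun τ : ℝ => G (S.ι t p.1, τ * p.2)) (uIcc 0 1) := by
      refine ContinuousOn.congr ((S.ι 0).continuous.comp_continuousOn h2) fun τ hτ => ?_
      exact (hge _ (Metric.scale_snd_mem_ball hp' (habs τ hτ))).symm
    exact ((continuousOn_id.pow n).smul h3).const_smul _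
  have := intervalIntegral.integral_eq_sub_of_hasDerivAt hder hcont.intervalIntegrable
  rw [intervalIntegral.integral_smul] at this
  have h5 := (h _ hp).1
  simp only [ιE_apply] at h5 ⊢
  rw [this]
  simp [h5]

end BanachScale

/-! ### The truncated flow and the truncated Lie series of a vector field -/

/-- The iterated Lie brackets `Y`, `[X, Y] = dY X - dX Y`, `[X, [X, Y]]`, … -/
def iterLie {V : Type*} [NormedAddCommGroup V] [NormedSpace ℝ V] (X Y : V → V) : ℕ → V → V
  | 0 => Y
  | l + 1 => fun z => lineDeriv ℝ (iterLie X Y l) z (X z) - lineDeriv ℝ X z (iterLie X Y l z)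

/-- The truncated Lie series `∑_{l=0}^{r} ε^l/l! [X, …, [X, Y]]` of the vector field `Y`. -/
def truncLieField {V : Type*} [NormedAddCommGroup V] [NormedSpace ℝ V] (X Y : V → V) (r : ℕ)
    (ε : ℝ) (z : V) : V :=
  ∑ l ∈ Finset.range (r + 1), (ε ^ l / (l.factorial : ℝ)) • iterLie X Y l z

namespace BanachScale

variable {B : ℕ → Type u} [∀ s, NormedAddCommGroup (B s)] [∀ s, NormedSpace ℝ (B s)]
  {S : BanachScale B}

/-- Maps which do not depend on the parameter. -/
theorem almostSmooth_iff {X : B 0 → B 0} : S.AlmostSmooth X ↔ S.Smooth (fun p => X p.1) := by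
  constructor
  · intro h k s'
    obtain ⟨s, U, f, hU, h0, hf, he⟩ := h k s'
    refine ⟨s, fun p => f p.1, ?_, ?_⟩
    · exact (hf.contDiffAt (hU.mem_nhds h0)).comp (0 : B s × ℝ) contDiff_fst.contDiffAt
    · have : Tendsto Prod.fst (𝓝 (0 : B s × ℝ)) (𝓝 0) := continuous_fst.tendsto _
      filter_upwards [this.eventually (hU.mem_nhds h0)] with p hp
      rw [he _ hp, ιE_apply]
  · intro h k s'
    obtain ⟨s, f, hf⟩ := h k s'
    obtain ⟨δ, hδ, hfs, hfe⟩ := hf.exists_ball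
    have hm : ∀ z ∈ Metric.ball (0 : B s) δ, (z, (0 : ℝ)) ∈ Metric.ball (0 : B s × ℝ) δ := by
      intro z hz
      rw [mem_ball_zero_iff, Prod.norm_def, max_lt_iff]
      exact ⟨by simpa using hz, by simpa using hδ⟩
    refine ⟨s, Metric.ball 0 δ, fun z => f (z, 0), Metric.isOpen_ball, Metric.mem_ball_self hδ,
      hfs.comp (f := fun z : B s => (z, (0 : ℝ))) (ContDiff.contDiffOn (by fun_prop)) hm, ?_⟩
    intro z hz
    rw [hfe _ (hm z hz), ιE_apply]

theorem Smooth.almostSmoothFamily {F : ℝ → B 0 → B 0} (hF : S.Smooth (fun p => F p.2 p.1)) :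
    S.AlmostSmoothFamily F := by
  intro k s'
  obtain ⟨s, f, hf⟩ := hF k s'
  obtain ⟨δ, hδ, hfs, hfe⟩ := hf.exists_ball
  have hm : ∀ z ∈ Metric.ball (0 : B s) δ, ∀ ε ∈ Ioo (-δ) δ,
      (z, ε) ∈ Metric.ball (0 : B s × ℝ) δ := by
    intro z hz ε hε
    rw [mem_ball_zero_iff, Prod.norm_def, max_lt_iff]
    exact ⟨by simpa using hz, abs_lt.2 hε⟩
  refine ⟨s, Metric.ball 0 δ, δ, f, Metric.isOpen_ball, Metric.mem_ball_self hδ, hδ,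
    hfs.mono fun p hp => hm _ hp.1 _ hp.2, fun z hz ε hε => ?_⟩
  rw [hfe _ (hm z hz ε hε), ιE_apply]

theorem lineDeriv_comp_fst (Y : B 0 → B 0) (p v : B 0 × ℝ) :
    lineDeriv ℝ (fun p : B 0 × ℝ => Y p.1) p v = lineDeriv ℝ Y p.1 v.1 := rfl

theorem Smooth.lineDeriv {X Y : B 0 → B 0} (hX : S.Smooth (fun p => X p.1))
    (hY : S.Smooth (fun p => Y p.1)) : S.Smooth (fun p => _root_.lineDeriv ℝ Y p.1 (X p.1)) :=
  hY.along hX 0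

theorem Smooth.iterField {X : B 0 → B 0} (hX : S.Smooth (fun p => X p.1)) (k : ℕ) :
    S.Smooth (fun p => _root_.iterField X k p.1) := by
  induction k with
  | zero => exact hX
  | succ k ih => exact Smooth.lineDeriv hX ih

theorem Smooth.iterLie {X Y : B 0 → B 0} (hX : S.Smooth (fun p => X p.1))
    (hY : S.Smooth (fun p => Y p.1)) (l : ℕ) : S.Smooth (fun p => _root_.iterLie X Y l p.1) := by
  induction l with
  | zero => exact hY
  | succ l ih => exact (Smooth.lineDeriv hX ih).sub (Smooth.lineDeriv ih hX)

theorem Smooth.expSum {Z : ℕ → B 0 × ℝ → B 0} (hZ : ∀ k, S.Smooth (Z k)) (n : ℕ) :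
    S.Smooth (fun p => ∑ k ∈ Finset.range n, (p.2 ^ k / (k.factorial : ℝ)) • Z k p) :=
  Smooth.sum (F := fun k p => (p.2 ^ k / (k.factorial : ℝ)) • Z k p)
    (fun k => (hZ k).smul (φ := fun e => e ^ k / (k.factorial : ℝ))
      fun _ => (contDiff_id.pow k).div_const _) n

/-- The derivative of a truncated exponential sum `∑ ε ^ k / k! Z_k` along `(V, -1)`. -/
theorem Smooth.along_expSum {Z : ℕ → B 0 × ℝ → B 0} (hZ : ∀ k, S.Smooth (Z k))
    {V : B 0 × ℝ → B 0} (hV : S.Smooth V) (n : ℕ) :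
    BanachScale.along
      (fun p => ∑ k ∈ Finset.range (n + 1), (p.2 ^ k / (k.factorial : ℝ)) • Z k p) V (-1)
    =ᶠ[S.nhdsE] fun p =>
      ∑ k ∈ Finset.range (n + 1), (p.2 ^ k / (k.factorial : ℝ)) • BanachScale.along (Z k) V (-1) p
      - ∑ k ∈ Finset.range n, (p.2 ^ k / (k.factorial : ℝ)) • Z (k + 1) p := by
  have h1 : ∀ᶠ p in S.nhdsE, ∀ k ∈ Finset.range (n + 1),
      HasLineDerivAt ℝ (Z k) (BanachScale.along (Z k) V (-1) p) p (V p, -1) :=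
    (Filter.eventually_all_finset _).2 fun k _ => (hZ k).hasLineDerivAt hV (-1)
  filter_upwards [h1] with p hp
  have hterm : ∀ k ∈ Finset.range (n + 1), HasDerivAt
      (fun t : ℝ => ((p + t • (V p, (-1 : ℝ))).2 ^ k / (k.factorial : ℝ)) •
        Z k (p + t • (V p, (-1 : ℝ))))
      ((p.2 ^ k / (k.factorial : ℝ)) • BanachScale.along (Z k) V (-1) p
        - ((k * p.2 ^ (k - 1)) / (k.factorial : ℝ)) • Z k p) 0 := by
    intro k hk
    have e1 : HasDerivAt (fun t : ℝ => p.2 + t * (-1)) (-1) 0 := by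
      simpa using ((hasDerivAt_id (0 : ℝ)).mul_const (-1)).const_add p.2
    have e2 : HasDerivAt (fun t : ℝ => (p + t • (V p, (-1 : ℝ))).2 ^ k / (k.factorial : ℝ))
        (-((k * p.2 ^ (k - 1)) / (k.factorial : ℝ))) 0 := by
      refine ((e1.pow k).div_const (k.factorial : ℝ)).congr_deriv ?_
      rw [zero_mul, add_zero]
      ring
    refine (e2.smul (hp k hk)).congr_deriv ?_
    simp [sub_eq_add_neg]
  have hsum := HasDerivAt.fun_sum hterm
  refine hsum.deriv.trans ?_
  rw [Finset.sum_sub_distrib]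
  congr 1
  rw [Finset.sum_range_succ']
  simp only [Nat.cast_zero, zero_mul, zero_div, zero_smul, add_zero]
  refine Finset.sum_congr rfl fun k _ => ?_
  congr 1
  rw [Nat.factorial_succ, add_tsub_cancel_right]
  push_cast
  field_simp

/-- The Taylor coefficients `z, X, X^(1), …` of the formal flow of `X`, the identity being the
zeroth one; with this indexing the truncated flow is a truncated exponential sum. -/
def flowCoeff (X : B 0 → B 0) : ℕ → B 0 × ℝ → B 0
  | 0 => fun p => p.1
  | k + 1 => fun p => iterField X k p.1

theorem truncFlow_eq (X : B 0 → B 0) (r : ℕ) (p : B 0 × ℝ) :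
    truncFlow X r p.2 p.1 =
      ∑ k ∈ Finset.range (r + 1), (p.2 ^ k / (k.factorial : ℝ)) • flowCoeff X k p := by
  rw [Finset.sum_range_succ', truncFlow]
  simp [flowCoeff, add_comm]

theorem Smooth.flowCoeff {X : B 0 → B 0} (hX : S.Smooth (fun p => X p.1)) (k : ℕ) :
    S.Smooth (BanachScale.flowCoeff X k) := by
  cases k with
  | zero => exact S.smooth_fst
  | succ k => exact hX.iterField k

theorem Smooth.truncFlow {X : B 0 → B 0} (hX : S.Smooth (fun p => X p.1)) (r : ℕ) :
    S.Smooth (fun p => _root_.truncFlow X r p.2 p.1) := by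
  simp only [truncFlow_eq]
  exact Smooth.expSum hX.flowCoeff (r + 1)

theorem Smooth.truncLieField {X Y : B 0 → B 0} (hX : S.Smooth (fun p => X p.1))
    (hY : S.Smooth (fun p => Y p.1)) (r : ℕ) :
    S.Smooth (fun p => _root_.truncLieField X Y r p.2 p.1) :=
  Smooth.expSum (hX.iterLie hY) (r + 1)

/-- The truncated flow solves the transport equation `∂_ε T = dT X` up to `O(ε ^ r)`. -/
theorem Smooth.along_truncFlow {X : B 0 → B 0} (hX : S.Smooth (fun p => X p.1)) (r : ℕ) :
    BanachScale.along (fun p => _root_.truncFlow X r p.2 p.1) (fun p => X p.1) (-1) =ᶠ[S.nhdsE]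
      fun p => (p.2 ^ r / (r.factorial : ℝ)) • _root_.iterField X r p.1 := by
  simp only [truncFlow_eq]
  filter_upwards [Smooth.along_expSum hX.flowCoeff hX r] with p hp
  rw [hp]
  have h1 : ∀ k, BanachScale.along (BanachScale.flowCoeff X k)
      (fun p => X p.1) (-1) p = _root_.iterField X k p.1 := by
    intro k
    cases k with
    | zero =>
      refine HasDerivAt.deriv ?_
      have h2 : HasDerivAt (fun t : ℝ => p.1 + t • X p.1) (X p.1) 0 := by
        simpa using! ((hasDerivAt_id (0 : ℝ)).smul_const (X p.1)).const_add p.1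
      exact h2
    | succ k => rfl
  simp only [h1]
  rw [Finset.sum_range_succ]
  exact add_sub_cancel_left _ _

/-- The truncated Lie series solves `∂_ε W = [X, W]` up to `O(ε ^ r)`. -/
theorem Smooth.along_truncLieField {X Y : B 0 → B 0} (hX : S.Smooth (fun p => X p.1))
    (hY : S.Smooth (fun p => Y p.1)) (r : ℕ) :
    (fun p => BanachScale.along (fun p => _root_.truncLieField X Y r p.2 p.1)
        (fun p => X p.1) (-1) p
      - BanachScale.along (fun p => X p.1) (fun p => _root_.truncLieField X Y r p.2 p.1) 0 p)
      =ᶠ[S.nhdsE]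
      fun p => (p.2 ^ r / (r.factorial : ℝ)) • _root_.iterLie X Y (r + 1) p.1 := by
  filter_upwards [Smooth.along_expSum (hX.iterLie hY) hX r,
    hX.along_sum_dir (V := fun l p => (p.2 ^ l / (l.factorial : ℝ)) • _root_.iterLie X Y l p.1)
      (fun l => (hX.iterLie hY l).smul (φ := fun e => e ^ l / (l.factorial : ℝ))
        fun _ => (contDiff_id.pow l).div_const _) (r + 1)] with p h1 h2
  simp only [_root_.truncLieField]
  rw [h1, h2]
  have h3 : ∀ l, BanachScale.along (fun p => X p.1)
      (fun p => (p.2 ^ l / (l.factorial : ℝ)) • _root_.iterLie X Y l p.1) 0 p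
      = (p.2 ^ l / (l.factorial : ℝ)) • _root_.lineDeriv ℝ X p.1 (_root_.iterLie X Y l p.1) :=
    fun l => along_smul_dir (fun p => X p.1) (fun p => _root_.iterLie X Y l p.1)
      (fun e => e ^ l / (l.factorial : ℝ)) p
  simp only [h3]
  have h4 : ∑ k ∈ Finset.range (r + 1), (p.2 ^ k / (k.factorial : ℝ)) •
        BanachScale.along (fun p => _root_.iterLie X Y k p.1) (fun p => X p.1) (-1) p
      - ∑ k ∈ Finset.range (r + 1), (p.2 ^ k / (k.factorial : ℝ)) •
        _root_.lineDeriv ℝ X p.1 (_root_.iterLie X Y k p.1)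
      = ∑ k ∈ Finset.range (r + 1), (p.2 ^ k / (k.factorial : ℝ)) •
        _root_.iterLie X Y (k + 1) p.1 := by
    rw [← Finset.sum_sub_distrib]
    refine Finset.sum_congr rfl fun k _ => ?_
    rw [← smul_sub]
    rfl
  rw [sub_right_comm, h4, Finset.sum_range_succ, add_sub_cancel_left]

/-- The truncated flow conjugates the truncated Lie series of `Y` to `Y` up to `O(ε ^ (r + 1))`. -/
theorem Smooth.exists_conjugation_eq [∀ s, CompleteSpace (B s)] {X Y : B 0 → B 0}
    (hX : S.Smooth (fun p => X p.1)) (hY : S.Smooth (fun p => Y p.1)) (r : ℕ) :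
    ∃ Q, S.Smooth Q ∧
      (fun p => BanachScale.along (fun p => _root_.truncFlow X r p.2 p.1)
        (fun p => _root_.truncLieField X Y r p.2 p.1) 0 p - Y (_root_.truncFlow X r p.2 p.1))
      =ᶠ[S.nhdsE] fun p => p.2 ^ (r + 1) • Q p := by
  set T : B 0 × ℝ → B 0 := fun p => _root_.truncFlow X r p.2 p.1 with hT
  set W : B 0 × ℝ → B 0 := fun p => _root_.truncLieField X Y r p.2 p.1 with hW
  have sT : S.Smooth T := hX.truncFlow r
  have sW : S.Smooth W := hX.truncLieField hY r
  have hT0 : T 0 = 0 := by simp [hT, _root_.truncFlow]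
  have sYT : S.Smooth (fun p => Y (T p)) := hY.comp sT hT0
  set Φ : B 0 × ℝ → B 0 := fun p => BanachScale.along T W 0 p - Y (T p) with hΦ
  have sΦ : S.Smooth Φ := (sT.along sW 0).sub sYT
  set A : B 0 × ℝ → B 0 := fun p => ((r.factorial : ℝ)⁻¹) • _root_.iterField X r p.1 with hA
  set D : B 0 × ℝ → B 0 := fun p => ((r.factorial : ℝ)⁻¹) • _root_.iterLie X Y (r + 1) p.1 with hD
  have sA : S.Smooth A := (hX.iterField r).const_smul _
  have sD : S.Smooth D := (hX.iterLie hY (r + 1)).const_smul _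
  -- `Φ` solves a transport equation with a source of order `ε ^ r`
  have htrans : ∃ Ψ, S.Smooth Ψ ∧
      BanachScale.along Φ (fun p => X p.1) (-1) =ᶠ[S.nhdsE] fun p => p.2 ^ r • Ψ p := by
    refine ⟨fun p => BanachScale.along A W 0 p + BanachScale.along T D 0 p
      - _root_.lineDeriv ℝ (fun p : B 0 × ℝ => Y p.1) (T p, p.2) (A p, 0),
      ((sA.along sW 0).add (sT.along sD 0)).sub (hY.lineDeriv_comp sT hT0 sA 0), ?_⟩
    have e1 : BanachScale.along T (fun p => X p.1) (-1) =ᶠ[S.nhdsE] fun p => p.2 ^ r • A p := by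
      filter_upwards [hX.along_truncFlow r] with p hp
      rw [hp, hA, smul_smul, div_eq_mul_inv]
    have e2 : (fun p => BanachScale.along W (fun p => X p.1) (-1) p
        - BanachScale.along (fun p => X p.1) W 0 p) =ᶠ[S.nhdsE] fun p => p.2 ^ r • D p := by
      filter_upwards [hX.along_truncLieField hY r] with p hp
      rw [hp, hD, smul_smul, div_eq_mul_inv]
    filter_upwards [(sT.along sW 0).along_sub sYT hX (-1), sT.along_along hX sW (-1) 0,
      along_congr sW e1 0, along_congr_dir (F := T) e2 0, hY.along_comp sT hT0 hX (-1), e1]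
      with p h1 h2 h3 h4 h5 h6
    rw [hΦ, h1, h2, h3, h4, h5, h6, along_smul A W (fun e => e ^ r),
      along_smul_dir T D (fun e => e ^ r), lineDeriv_comp_fst, lineDeriv_comp_fst]
    simp only [lineDeriv_smul, smul_add, smul_sub]
  obtain ⟨Ψ, sΨ, hΨ⟩ := htrans
  have h0 : ∀ p : B 0 × ℝ, Φ (p.1, 0) = 0 := by
    intro p
    have hz : ∀ z, T (z, 0) = z := by simp [hT, _root_.truncFlow]
    have hw : W (p.1, 0) = Y p.1 := by
      simp [hW, _root_.truncLieField, Finset.sum_range_succ', _root_.iterLie]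
    have : BanachScale.along T W 0 (p.1, 0) = Y p.1 := by
      refine HasDerivAt.deriv ?_
      simp only [Prod.smul_mk, smul_zero, Prod.mk_add_mk, add_zero, hz, hw]
      simpa using ((hasDerivAt_id (0 : ℝ)).smul_const (Y p.1)).const_add p.1
    simp only [hΦ, this, hz, sub_self]
  have key : ∀ n ≤ r + 1, ∃ Q, S.Smooth Q ∧ Φ =ᶠ[S.nhdsE] fun p => p.2 ^ n • Q p := by
    -- `∂_ε Φ = dΦ X - ε ^ r Ψ`, and `dΦ X` is divisible by `ε ^ n` if `Φ` is
    intro n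
    induction n with
    | zero => exact fun _ => ⟨Φ, sΦ, Eventually.of_forall fun p => by simp⟩
    | succ n ih =>
      intro hn
      obtain ⟨Q, sQ, hQ⟩ := ih (by omega)
      refine sΦ.exists_eq_pow_smul ((sQ.along hX 0).sub (sΨ.pow_smul (r - n))) n
        (Eventually.of_forall h0) ?_
      filter_upwards [sΦ.along_add hX S.smooth_zero (-1) 1, along_congr hX hQ 0, hΨ]
        with p h1 h2 h3
      simp only [add_zero, neg_add_cancel] at h1
      rw [h2, h3, along_smul Q _ (fun e => e ^ n)] at h1
      rw [← sub_eq_iff_eq_add'.2 h1, smul_sub, smul_smul, ← pow_add,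
        Nat.add_sub_cancel' (by omega : n ≤ r)]
  exact key (r + 1) le_rfl

end BanachScale

/-! ### Weak Hamiltonian vector fields -/

/-- If `y ↦ df(y) j` is strictly differentiable at `z`, then `t ↦ df(z + t j) v` is differentiable
at `0`: one of the mixed second derivatives exists and is equal to the other one, although `f` is
only assumed to be differentiable. -/
theorem hasDerivAt_fderiv_of_hasStrictFDerivAt {Z : Type*} [NormedAddCommGroup Z]
    [NormedSpace ℝ Z] {f ℓ : Z → ℝ} {ℓ' : Z →L[ℝ] ℝ} {z j : Z}
    (hf : ∀ᶠ y in 𝓝 z, DifferentiableAt ℝ f y) (hℓ : ∀ᶠ y in 𝓝 z, fderiv ℝ f y j = ℓ y)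
    (h : HasStrictFDerivAt ℓ ℓ' z) (v : Z) :
    HasDerivAt (fun t : ℝ => fderiv ℝ f (z + t • j) v) (ℓ' v) 0 := by
  rw [hasDerivAt_iff_isLittleO, Asymptotics.isLittleO_iff]
  intro c hc
  have hc' : 0 < c / (‖v‖ + 1) := by positivity
  have h1 := (Asymptotics.isLittleO_iff.1 h.isLittleO) hc'
  have h2 : ∀ᶠ y in 𝓝 z, DifferentiableAt ℝ f y ∧ fderiv ℝ f y j = ℓ y := hf.and hℓ
  have c1 : Tendsto (fun p : ℝ × ℝ => z + p.1 • j + p.2 • v) (𝓝 0) (𝓝 z) := by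
    have : Continuous fun p : ℝ × ℝ => z + p.1 • j + p.2 • v := by fun_prop
    simpa using this.tendsto 0
  have c2 : Tendsto (fun p : ℝ × ℝ => (z + p.1 • j + p.2 • v, z + p.1 • j)) (𝓝 0) (𝓝 (z, z)) := by
    have : Continuous fun p : ℝ × ℝ => (z + p.1 • j + p.2 • v, z + p.1 • j) := by fun_prop
    simpa using this.tendsto 0
  obtain ⟨δ, hδ, hball⟩ := Metric.eventually_nhds_iff_ball.1
    ((c1.eventually h2).and (c2.eventually h1))
  have hmem : ∀ a b : ℝ, |a| < δ → |b| < δ → (a, b) ∈ Metric.ball (0 : ℝ × ℝ) δ := by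
    intro a b ha hb
    rw [mem_ball_zero_iff, Prod.norm_def, max_lt_iff]
    exact ⟨ha, hb⟩
  have hder : ∀ a b : ℝ, |a| < δ → |b| < δ →
      HasDerivAt (fun a : ℝ => f (z + a • j + b • v)) (ℓ (z + a • j + b • v)) a := by
    intro a b ha hb
    obtain ⟨hd, he⟩ := (hball _ (hmem a b ha hb)).1
    rw [← he]
    have hline : HasDerivAt (fun a : ℝ => z + a • j + b • v) j a := by
      simpa using! (((hasDerivAt_id a).smul_const j).const_add z).add_const (b • v)
    exact hd.hasFDerivAt.comp_hasDerivAt a hline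
  -- the increment in the direction `v` of the increment in the direction `j`
  have hmvt : ∀ a b : ℝ, |a| < δ → |b| < δ →
      |(f (z + a • j + b • v) - f (z + a • j)) - (f (z + b • v) - f z) - a * (b * ℓ' v)|
        ≤ c * |b| * |a| := by
    intro a b ha hb
    have key := (convex_ball (0 : ℝ) δ).norm_image_sub_le_of_norm_hasDerivWithin_le
      (f := fun a : ℝ => f (z + a • j + b • v) - f (z + a • j + (0 : ℝ) • v) - a * (b * ℓ' v))
      (f' := fun a => ℓ (z + a • j + b • v) - ℓ (z + a • j + (0 : ℝ) • v) - b * ℓ' v)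
      (C := c * |b|) (x := 0) (y := a) ?_ ?_ (Metric.mem_ball_self hδ) (by simpa using ha)
    · simpa [Real.norm_eq_abs, sub_right_comm] using key
    · intro x hx
      have hx' : |x| < δ := by simpa using hx
      refine HasDerivAt.hasDerivWithinAt ?_
      refine ((hder x b hx' hb).sub (hder x 0 hx' (by simpa using hδ))).sub ?_
      simpa using (hasDerivAt_id x).mul_const (b * ℓ' v)
    · intro x hx
      have hx' : |x| < δ := by simpa using hx
      have := (hball _ (hmem x b hx' hb)).2
      simp only [add_sub_cancel_left, map_smul, smul_eq_mul, zero_smul, add_zero] at this ⊢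
      refine this.trans ?_
      rw [norm_smul, Real.norm_eq_abs]
      calc c / (‖v‖ + 1) * (|b| * ‖v‖) = c * |b| * (‖v‖ / (‖v‖ + 1)) := by ring
        _ ≤ c * |b| * 1 := by
          gcongr
          rw [div_le_one (by positivity)]
          linarith
        _ = c * |b| := mul_one _
  have hquot : ∀ y, DifferentiableAt ℝ f y →
      Tendsto (fun b : ℝ => b⁻¹ * (f (y + b • v) - f y)) (𝓝[≠] 0) (𝓝 (fderiv ℝ f y v)) := by
    intro y hy
    have := hasDerivAt_iff_tendsto_slope_zero.1 (hy.hasFDerivAt.hasLineDerivAt v)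
    simpa using this
  filter_upwards [Metric.ball_mem_nhds (0 : ℝ) hδ] with a ha
  have ha' : |a| < δ := by simpa using ha
  have h0 : |(0 : ℝ)| < δ := by simpa using hδ
  have t1 := hquot (z + a • j) (by simpa using (hball _ (hmem a 0 ha' h0)).1.1)
  have t2 := hquot z (by simpa using (hball _ (hmem 0 0 h0 h0)).1.1)
  have t3 := ((t1.sub t2).sub_const (a * ℓ' v)).norm
  simp only [sub_zero, zero_smul, add_zero, smul_eq_mul]
  refine le_of_tendsto t3 ?_
  have hb : ∀ᶠ b : ℝ in 𝓝[≠] 0, |b| < δ :=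
    nhdsWithin_le_nhds (by
      filter_upwards [Metric.ball_mem_nhds (0 : ℝ) hδ] with b hb using by simpa using hb)
  filter_upwards [hb, self_mem_nhdsWithin] with b hb hb0
  have hb0' : b ≠ 0 := hb0
  have := hmvt a b ha' hb
  rw [Real.norm_eq_abs, Real.norm_eq_abs]
  have e : b⁻¹ * (f (z + a • j + b • v) - f (z + a • j)) - b⁻¹ * (f (z + b • v) - f z) - a * ℓ' v
      = b⁻¹ * ((f (z + a • j + b • v) - f (z + a • j)) - (f (z + b • v) - f z)
        - a * (b * ℓ' v)) := by
    field_simp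
  rw [e, abs_mul, abs_inv]
  rw [inv_mul_le_iff₀ (abs_pos.2 hb0')]
  linarith

/-- The product rule at a zero of the vector factor requires only continuity of the operator
factor. -/
theorem HasFDerivAt.clm_apply_of_eq_zero {Z Y V : Type*} [NormedAddCommGroup Z] [NormedSpace ℝ Z]
    [NormedAddCommGroup Y] [NormedSpace ℝ Y] [NormedAddCommGroup V] [NormedSpace ℝ V]
    {A : Z → Y →L[ℝ] V} {u : Z → Y} {u' : Z →L[ℝ] Y} {z : Z} (hA : ContinuousAt A z)
    (hu : HasFDerivAt u u' z) (h0 : u z = 0) :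
    HasFDerivAt (fun y => A y (u y)) ((A z).comp u') z := by
  have h1 : HasFDerivAt (fun y => A z (u y)) ((A z).comp u') z := (A z).hasFDerivAt.comp z hu
  suffices h : HasFDerivAt (fun y => (A y - A z) (u y)) (0 : Z →L[ℝ] V) z from
    ((h1.add h).congr_fderiv (add_zero _)).congr_of_eventuallyEq
      (Eventually.of_forall fun y => by simp)
  rw [hasFDerivAt_iff_isLittleO]
  simp only [sub_self, h0, map_zero, sub_zero, zero_apply]
  have h2 : (fun y => A y - A z) =o[𝓝 z] (fun _ => (1 : ℝ)) :=
    (Asymptotics.isLittleO_one_iff ℝ).2 (by simpa using Tendsto.sub_const hA (A z))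
  have h3 : u =O[𝓝 z] (fun y => y - z) := by simpa [h0] using hu.isBigO_sub
  have h4 := h2.norm_left.mul_isBigO h3.norm_norm
  simp only [one_mul] at h4
  refine (Asymptotics.IsBigO.of_norm_le fun y => ?_).trans_isLittleO h4.of_norm_right
  exact (A y - A z).le_opNorm (u y)

namespace BanachScale

variable {B : ℕ → Type*} [∀ s, NormedAddCommGroup (B s)] [∀ s, NormedSpace ℝ (B s)]
  {S : BanachScale B}

theorem AlmostSmooth.exists_contDiffAt {X : B 0 → B 0} (hX : S.AlmostSmooth X) (k s' s₀ : ℕ) :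
    ∃ (s : ℕ) (_ : s₀ ≤ s) (x : B s → B s'), ContDiffAt ℝ k x 0 ∧
      ∀ᶠ z in 𝓝 (0 : B s), S.ι s' (x z) = X (S.ι s z) := by
  obtain ⟨s, U, f, hU, h0, hf, he⟩ := hX k s'
  have ht := S.tendsto_incl (le_max_left s s₀)
  refine ⟨max s s₀, le_max_right _ _, fun z => f (S.incl (le_max_left s s₀) z), ?_, ?_⟩
  · have h1 : ContDiffAt ℝ k f (S.incl (le_max_left s s₀) 0) := by
      rw [map_zero]
      exact hf.contDiffAt (hU.mem_nhds h0)
    exact h1.comp (0 : B (max s s₀)) (S.incl _).contDiff.contDiffAt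
  · filter_upwards [ht.eventually (hU.mem_nhds h0)] with z hz
    rw [he _ hz, ι_incl]

theorem hasLineDerivAt_ι {V V' : Type*} [NormedAddCommGroup V] [NormedSpace ℝ V]
    [NormedAddCommGroup V'] [NormedSpace ℝ V'] (L : V' →L[ℝ] V) {F : B 0 → V} {s : ℕ}
    {f : B s → V'} {z : B s} (hd : DifferentiableAt ℝ f z)
    (he : ∀ᶠ y in 𝓝 z, L (f y) = F (S.ι s y)) (v : B s) :
    HasLineDerivAt ℝ F (L (fderiv ℝ f z v)) (S.ι s z) (S.ι s v) := by
  have h1 : HasLineDerivAt ℝ (fun y => L (f y)) (L (fderiv ℝ f z v)) z v :=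
    (L.hasFDerivAt.comp z hd.hasFDerivAt).hasLineDerivAt v
  have h2 : ∀ᶠ t : ℝ in 𝓝 0, L (f (z + t • v)) = F (S.ι s z + t • S.ι s v) := by
    have : Tendsto (fun t : ℝ => z + t • v) (𝓝 0) (𝓝 z) := by
      have : Continuous fun t : ℝ => z + t • v := by fun_prop
      simpa using this.tendsto 0
    filter_upwards [this.eventually he] with t ht
    rw [ht, map_add, map_smul]
  exact HasDerivAt.congr_of_eventuallyEq h1 (h2.mono fun t ht => ht.symm)

theorem hasLineDerivAt_ι_self {F : B 0 → ℝ} {s : ℕ} {z : B s}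
    (hd : DifferentiableAt ℝ (fun z : B s => F (S.ι s z)) z) (v : B s) :
    HasLineDerivAt ℝ F (fderiv ℝ (fun z : B s => F (S.ι s z)) z v) (S.ι s z) (S.ι s v) :=
  hasLineDerivAt_ι (ContinuousLinearMap.id ℝ ℝ) hd (Eventually.of_forall fun _ => rfl) v

end BanachScale

namespace HamiltonianScale

open BanachScale

variable {B : ℕ → Type u} [∀ s, NormedAddCommGroup (B s)] [∀ s, NormedSpace ℝ (B s)]
  {E : Type*} [NormedAddCommGroup E] [InnerProductSpace ℝ E] {S : HamiltonianScale B E}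

theorem proj_mem_all (N : ℕ) (x : B 0) (s : ℕ) :
    ∃ h' : B s, S.ι s h' = S.ι S.m (S.proj N S.m x) :=
  ⟨S.proj N s x, by rw [S.proj_compat, S.proj_compat]⟩

/-- Weak Hamiltonian vectors are unique. -/
theorem IsHamVec.unique {F : B 0 → ℝ} {z : B 0} {w w' : B S.m} (h : S.IsHamVec F z w)
    (h' : S.IsHamVec F z w') : w = w' := by
  have h1 : ∀ N, ⟪S.toE (w - w'), S.toE (S.proj N S.m (S.ι S.m (w - w')))⟫ = 0 := by
    intro N
    have e1 := h (S.proj N S.m (S.ι S.m (w - w'))) (proj_mem_all N _)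
    have e2 := h' (S.proj N S.m (S.ι S.m (w - w'))) (proj_mem_all N _)
    rw [map_sub S.toE, inner_sub_left, e1, e2, sub_self]
  have h2 : Tendsto (fun N => ⟪S.toE (w - w'), S.toE (S.proj N S.m (S.ι S.m (w - w')))⟫) atTop
      (𝓝 ⟪S.toE (w - w'), S.toE (w - w')⟫) :=
    tendsto_const_nhds.inner ((S.toE.continuous.tendsto _).comp (S.proj_tendsto S.m (w - w')))
  simp only [h1] at h2
  have h3 := tendsto_nhds_unique h2 tendsto_const_nhds
  rw [inner_self_eq_zero] at h3
  exact sub_eq_zero.1 ((map_eq_zero_iff _ S.toE_injective).1 h3)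

/-- The weak Hamiltonian vector determines the differential on the range of `J`, not only on the
image of the smooth vectors. -/
theorem IsHamVec.fderiv_eq {F : B 0 → ℝ} {s : ℕ} {z : B s} {w : B S.m}
    (h : S.IsHamVec F (S.ι s z) w) (hd : DifferentiableAt ℝ (fun z : B s => F (S.ι s z)) z)
    {q : B S.m} {v : B s} (hq : S.J q = S.ι s v) :
    fderiv ℝ (fun z : B s => F (S.ι s z)) z v = -⟪S.toE w, S.toE q⟫ := by
  have h1 : ∀ N, fderiv ℝ (fun z : B s => F (S.ι s z)) z (S.proj N s (S.ι s v))
      = -⟪S.toE w, S.toE (S.proj N S.m (S.ι S.m q))⟫ := by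
    intro N
    rw [h _ (proj_mem_all N _), neg_neg, S.proj_comm_J, hq, ← S.proj_compat N s]
    exact (hasLineDerivAt_ι_self hd _).lineDeriv.symm
  have h2 : Tendsto (fun N => fderiv ℝ (fun z : B s => F (S.ι s z)) z (S.proj N s (S.ι s v))) atTop
      (𝓝 (fderiv ℝ (fun z : B s => F (S.ι s z)) z v)) :=
    ((fderiv ℝ (fun z : B s => F (S.ι s z)) z).continuous.tendsto _).comp (S.proj_tendsto s v)
  simp only [h1] at h2
  refine tendsto_nhds_unique h2 (Tendsto.neg ?_)
  exact tendsto_const_nhds.inner ((S.toE.continuous.tendsto _).comp (S.proj_tendsto S.m q))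

/-- `F` is of class `C^1` near the origin of some `B s` and `W` is there its Hamiltonian vector
field in the weak sense. Almost smoothness of `W` is not part of the definition. -/
def HasWeakField (S : HamiltonianScale B E) (F : B 0 → ℝ) (W : B 0 → B 0) : Prop :=
  ∃ s : ℕ, ∀ᶠ z in 𝓝 (0 : B s), ContDiffAt ℝ 1 (fun z : B s => F (S.ι s z)) z ∧
    ∃ w : B S.m, S.ι S.m w = W (S.ι s z) ∧ S.IsHamVec F (S.ι s z) w

theorem contDiffAt_of_le {F : B 0 → ℝ} {s t : ℕ} (h : s ≤ t) {z : B t}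
    (hF : ContDiffAt ℝ 1 (fun z : B s => F (S.ι s z)) (S.incl h z)) :
    ContDiffAt ℝ 1 (fun z : B t => F (S.ι t z)) z := by
  have := hF.comp z (S.incl h).contDiff.contDiffAt
  simpa only [Function.comp_def, ι_incl] using this

theorem HasWeakField.exists_forall_ge {F : B 0 → ℝ} {W : B 0 → B 0} (h : S.HasWeakField F W) :
    ∃ s : ℕ, ∀ t ≥ s, ∀ᶠ z in 𝓝 (0 : B t), ContDiffAt ℝ 1 (fun z : B t => F (S.ι t z)) z ∧
      ∃ w : B S.m, S.ι S.m w = W (S.ι t z) ∧ S.IsHamVec F (S.ι t z) w := by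
  obtain ⟨s, hs⟩ := h
  refine ⟨s, fun t ht => ?_⟩
  filter_upwards [(S.tendsto_incl ht).eventually hs] with z hz
  rw [ι_incl] at hz
  exact ⟨contDiffAt_of_le ht hz.1, hz.2⟩

theorem IsGradientAt.of_le {F : B 0 → ℝ} {s t : ℕ} {hs : S.m ≤ s} (h : s ≤ t) {z : B t}
    {g : B S.m} (hg : S.IsGradientAt F hs (S.incl h z) g) :
    S.IsGradientAt F (hs.trans h) z g := by
  have h1 := HasFDerivAt.comp z hg (S.incl h).hasFDerivAt
  simp only [Function.comp_def, ι_incl] at h1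
  refine h1.congr_fderiv ?_
  ext v
  simp [S.incl_trans]

theorem IsHamiltonianField.exists_forall_ge {F : B 0 → ℝ} {X : B 0 → B 0}
    (h : S.IsHamiltonianField F X) :
    ∃ (s : ℕ) (hs : S.m ≤ s), ∀ t (ht : s ≤ t), ∀ᶠ z in 𝓝 (0 : B t),
      ContDiffAt ℝ 1 (fun z : B t => F (S.ι t z)) z ∧
      ∃ g : B S.m, S.IsGradientAt F (hs.trans ht) z g ∧ S.J g = X (S.ι t z) := by
  obtain ⟨s, hs, U, hU, h0, hc, hg⟩ := h
  refine ⟨s, hs, fun t ht => ?_⟩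
  filter_upwards [(S.tendsto_incl ht).eventually (hU.mem_nhds h0)] with z hz
  obtain ⟨g, h1, h2⟩ := hg _ hz
  rw [ι_incl] at h2
  exact ⟨contDiffAt_of_le ht (hc.contDiffAt (hU.mem_nhds hz)), g, h1.of_le ht, h2⟩

theorem IsHamiltonianField.hasWeakField {F : B 0 → ℝ} {X : B 0 → B 0}
    (h : S.IsHamiltonianField F X) (hX : S.AlmostSmooth X) : S.HasWeakField F X := by
  obtain ⟨s, hs, h1⟩ := h.exists_forall_ge
  obtain ⟨t, ht, x, -, hx⟩ := hX.exists_contDiffAt 0 S.m s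
  refine ⟨t, ?_⟩
  filter_upwards [h1 t ht, hx] with z h2 h3
  obtain ⟨hc, g, hg, hJ⟩ := h2
  exact ⟨hc, x z, h3, S.isHamVec_of_gradient F _ z g _ hg (hJ.trans h3.symm)⟩

/-- The data at a point `y` of `B t` from which the bracket of `F` and `G` is computed: the weak
Hamiltonian fields `w` of `F` and `x` of `G`, and the gradient `g` of `G`, all valued in `B m`. -/
structure IsBracketPoint (S : HamiltonianScale B E) (F G : B 0 → ℝ) (W X : B 0 → B 0) {t : ℕ}
    (hm : S.m ≤ t) (x w g : B t → B S.m) (y : B t) : Prop where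
  contDiffAt_left : ContDiffAt ℝ 1 (fun z : B t => F (S.ι t z)) y
  contDiffAt_right : ContDiffAt ℝ 1 (fun z : B t => G (S.ι t z)) y
  contDiffAt_x : ContDiffAt ℝ 1 x y
  contDiffAt_w : ContDiffAt ℝ 1 w y
  ι_x : S.ι S.m (x y) = X (S.ι t y)
  ι_w : S.ι S.m (w y) = W (S.ι t y)
  hamF : S.IsHamVec F (S.ι t y) (w y)
  hamG : S.IsHamVec G (S.ι t y) (x y)
  grad : S.IsGradientAt G hm y (g y)
  J_grad : S.J (g y) = X (S.ι t y)

/-- The weak Hamiltonian field of the Poisson bracket `{F; G} = dF X`, `X = J∇G`, is the Lie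
bracket of the fields. In particular the bracket is of class `C^1` although `dF` is merely
continuous. -/
theorem HasWeakField.bracket {F G : B 0 → ℝ} {W X : B 0 → B 0} (hF : S.HasWeakField F W)
    (hW : S.AlmostSmooth W) (hG : S.IsHamiltonianField G X) (hX : S.AlmostSmooth X) :
    S.HasWeakField (fun z => lineDeriv ℝ F z (X z))
      (fun z => lineDeriv ℝ W z (X z) - lineDeriv ℝ X z (W z)) := by
  obtain ⟨s₁, h₁⟩ := hF.exists_forall_ge
  obtain ⟨s₂, hs₂, h₂⟩ := hG.exists_forall_ge
  obtain ⟨s₃, hs₃, w₀, hw₀, hw₀'⟩ := hW.exists_contDiffAt 1 S.m (max s₁ s₂)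
  obtain ⟨t, ht, x₂, hx₂, hx₂'⟩ := hX.exists_contDiffAt 1 S.m s₃
  have hm : S.m ≤ t := hs₂.trans ((le_max_right s₁ s₂).trans (hs₃.trans ht))
  replace h₁ := h₁ t ((le_max_left s₁ s₂).trans (hs₃.trans ht))
  replace h₂ := h₂ t ((le_max_right s₁ s₂).trans (hs₃.trans ht))
  set w₂ : B t → B S.m := fun z => w₀ (S.incl ht z) with hw₂
  have hw₂c : ContDiffAt ℝ 1 w₂ 0 := by
    have : ContDiffAt ℝ 1 w₀ (S.incl ht 0) := by rw [map_zero]; exact_mod_cast hw₀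
    exact this.comp (0 : B t) (S.incl ht).contDiff.contDiffAt
  have hw₂' : ∀ᶠ z in 𝓝 (0 : B t), S.ι S.m (w₂ z) = W (S.ι t z) := by
    filter_upwards [(S.tendsto_incl ht).eventually hw₀'] with z hz
    rw [hw₂, hz, ι_incl]
  set F₂ : B t → ℝ := fun z => F (S.ι t z) with hF₂
  set G₂ : B t → ℝ := fun z => G (S.ι t z) with hG₂
  have hgsel : ∀ z : B t, ∃ g : B S.m, (∃ g : B S.m, S.IsGradientAt G hm z g ∧
      S.J g = X (S.ι t z)) → S.IsGradientAt G hm z g ∧ S.J g = X (S.ι t z) := by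
    intro z
    by_cases h : ∃ g : B S.m, S.IsGradientAt G hm z g ∧ S.J g = X (S.ι t z)
    · exact ⟨h.choose, fun _ => h.choose_spec⟩
    · exact ⟨0, fun h' => absurd h' h⟩
  choose g hg using hgsel
  have good : ∀ᶠ y in 𝓝 (0 : B t), S.IsBracketPoint F G W X hm x₂ w₂ g y := by
    filter_upwards [h₁, h₂, (by exact_mod_cast hx₂.eventually (by simp) :
      ∀ᶠ y in 𝓝 (0 : B t), ContDiffAt ℝ 1 x₂ y), hw₂c.eventually (by simp), hx₂', hw₂']
      with y e1 e2 e3 e4 e5 e6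
    obtain ⟨w, hw, hw'⟩ := e1.2
    have e7 : w = w₂ y := S.ι_injective S.m (hw.trans e6.symm)
    obtain ⟨hg1, hg2⟩ := hg y e2.2
    exact ⟨e1.1, e2.1, e3, e4, e5, e6, e7 ▸ hw',
      S.isHamVec_of_gradient G hm y (g y) _ hg1 (hg2.trans e5.symm), hg1, hg2⟩
  have dG : ∀ y, S.IsGradientAt G hm y (g y) → ∀ v : B t,
      fderiv ℝ G₂ y v = ⟪S.toE (g y), S.toE (S.incl hm v)⟫ := by
    intro y hy v
    rw [HasFDerivAt.fderiv hy]
    rfl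
  -- `x₃` and `w₃` represent `X` and `W` with values in `B t`, so that `dF` and `dG`, which are
  -- functionals on `B t`, can be applied to them
  obtain ⟨s₄, hs₄, x₀, hx₀, hx₀'⟩ := hX.exists_contDiffAt 1 t t
  obtain ⟨u, hu, w₃, hw₃, hw₃'⟩ := hW.exists_contDiffAt 1 t s₄
  have htu : t ≤ u := hs₄.trans hu
  set x₃ : B u → B t := fun z => x₀ (S.incl hu z) with hx₃
  have hx₃c : ContDiffAt ℝ 1 x₃ 0 := by
    have : ContDiffAt ℝ 1 x₀ (S.incl hu 0) := by rw [map_zero]; exact_mod_cast hx₀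
    exact this.comp (0 : B u) (S.incl hu).contDiff.contDiffAt
  have hx₃' : ∀ᶠ z in 𝓝 (0 : B u), S.ι t (x₃ z) = X (S.ι u z) := by
    filter_upwards [(S.tendsto_incl hu).eventually hx₀'] with z hz
    rw [hx₃, hz, ι_incl]
  set i : B u →L[ℝ] B t := S.incl htu with hi
  have hii : ∀ z, S.ι t (i z) = S.ι u z := fun z => S.toBanachScale.ι_incl htu z
  set f : B u → ℝ := fun z => lineDeriv ℝ F (S.ι u z) (X (S.ι u z)) with hf
  set f' : B u → B u →L[ℝ] ℝ := fun z => (fderiv ℝ F₂ (i z)).comp (fderiv ℝ x₃ z)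
    - (fderiv ℝ G₂ (i z)).comp (fderiv ℝ w₃ z) with hf'
  have good' : ∀ᶠ z in 𝓝 (0 : B u), ∀ᶠ z in 𝓝 z,
      ((∀ᶠ y in 𝓝 (i z), S.IsBracketPoint F G W X hm x₂ w₂ g y) ∧
      ContDiffAt ℝ 1 x₃ z ∧ ContDiffAt ℝ 1 w₃ z ∧
      S.ι t (x₃ z) = X (S.ι u z) ∧ S.incl hm (w₃ z) = w₂ (i z)) := by
    refine Filter.Eventually.eventually_nhds ?_
    filter_upwards [(S.tendsto_incl htu).eventually good.eventually_nhds,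
      hx₃c.eventually (by simp), (by exact_mod_cast hw₃.eventually (by simp) :
      ∀ᶠ y in 𝓝 (0 : B u), ContDiffAt ℝ 1 w₃ y), hx₃', hw₃'] with z e1 e2 e3 e4 e5
    refine ⟨e1, e2, e3, e4, S.ι_injective S.m ?_⟩
    rw [e1.self_of_nhds.ι_w, ι_incl, e5]
    exact congrArg W (hii z).symm
  have fval : ∀ z, DifferentiableAt ℝ F₂ (i z) → S.ι t (x₃ z) = X (S.ι u z) →
      f z = fderiv ℝ F₂ (i z) (x₃ z) := by
    intro z h1 h2
    simp only [hf]
    rw [← h2, ← hii]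
    exact (hasLineDerivAt_ι_self h1 _).lineDeriv
  -- the differential of the bracket
  have hder : ∀ᶠ z in 𝓝 (0 : B u), HasFDerivAt f (f' z) z ∧ ContinuousAt f' z := by
    filter_upwards [good'] with z hz
    obtain ⟨z1, z2, z3, z4, z5⟩ := hz.self_of_nhds
    have zp := z1.self_of_nhds
    have cG : ContinuousAt (fderiv ℝ G₂) (i z) :=
      (zp.contDiffAt_right.fderiv_right (m := 0) (by norm_num)).continuousAt
    have cF : ContinuousAt (fderiv ℝ F₂) (i z) :=
      (zp.contDiffAt_left.fderiv_right (m := 0) (by norm_num)).continuousAt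
    have cGi : ContinuousAt (fun y => fderiv ℝ G₂ (i y)) z :=
      ContinuousAt.comp (f := i) cG i.continuous.continuousAt
    have cFi : ContinuousAt (fun y => fderiv ℝ F₂ (i y)) z :=
      ContinuousAt.comp (f := i) cF i.continuous.continuousAt
    constructor
    -- the exact identity for the increment of `f`; only `x₃` and `w₃` are differentiated in it
    · have hinc : f =ᶠ[𝓝 z] fun y => f z + fderiv ℝ F₂ (i z) (x₃ y - x₃ z)
          - fderiv ℝ G₂ (i y) (w₃ y - w₃ z) := by
        filter_upwards [hz] with y hy
        obtain ⟨y1, y2, y3, y4, y5⟩ := hy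
        have yp := y1.self_of_nhds
        have a1 : S.J (g (i y)) = S.ι t (x₃ y) := by rw [yp.J_grad, hii, y4]
        have a2 : S.J (g (i z)) = S.ι t (x₃ z) := by rw [zp.J_grad, hii, z4]
        have a3 : S.J (g (i y) - g (i z)) = S.ι t (x₃ y - x₃ z) := by
          rw [map_sub, map_sub, a1, a2]
        rw [fval y (yp.contDiffAt_left.differentiableAt (by simp)) y4,
          fval z (zp.contDiffAt_left.differentiableAt (by simp)) z4,
          yp.hamF.fderiv_eq (yp.contDiffAt_left.differentiableAt (by simp)) a1,
          zp.hamF.fderiv_eq (zp.contDiffAt_left.differentiableAt (by simp)) a2,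
          zp.hamF.fderiv_eq (zp.contDiffAt_left.differentiableAt (by simp)) a3,
          dG _ yp.grad, map_sub, map_sub, map_sub,
          y5, z5, inner_sub_right, inner_sub_right, real_inner_comm (S.toE (w₂ (i y))),
          real_inner_comm (S.toE (w₂ (i z))) (S.toE (g (i y)))]
        ring
      have d1 : HasFDerivAt (fun y => x₃ y - x₃ z) (fderiv ℝ x₃ z) z :=
        (z2.differentiableAt (by simp)).hasFDerivAt.sub_const _
      have d2 : HasFDerivAt (fun y => w₃ y - w₃ z) (fderiv ℝ w₃ z) z :=
        (z3.differentiableAt (by simp)).hasFDerivAt.sub_const _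
      have d3 := (((fderiv ℝ F₂ (i z)).hasFDerivAt.comp z d1).const_add (f z)).sub
        (HasFDerivAt.clm_apply_of_eq_zero cGi d2 (sub_self _))
      exact d3.congr_of_eventuallyEq hinc
    · exact (cFi.clm_comp (z2.fderiv_right (m := 0) (by norm_num)).continuousAt).sub
        (cGi.clm_comp (z3.fderiv_right (m := 0) (by norm_num)).continuousAt)
  have hC1 : ContDiffAt ℝ 1 f 0 :=
    contDiffAt_one_iff.2 ⟨f', {z | HasFDerivAt f (f' z) z ∧ ContinuousAt f' z}, hder,
      fun z hz => hz.2.continuousWithinAt, fun z hz => hz.1⟩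
  refine ⟨u, ?_⟩
  filter_upwards [good', hder, hC1.eventually (by simp)] with z hz hdz hcz
  refine ⟨hcz, ?_⟩
  obtain ⟨z1, z2, z3, z4, z5⟩ := hz.self_of_nhds
  have zp := z1.self_of_nhds
  have hWz : S.ι t (w₃ z) = W (S.ι u z) := by
    rw [← S.toBanachScale.ι_incl hm, z5, zp.ι_w, hii]
  refine ⟨fderiv ℝ w₂ (i z) (x₃ z) - fderiv ℝ x₂ (i z) (w₃ z), ?_, ?_⟩
  · have a1 := (hasLineDerivAt_ι (S := S.toBanachScale) (F := W) (S.ι S.m)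
      (zp.contDiffAt_w.differentiableAt (by simp)) (z1.mono fun y hy => hy.ι_w) (x₃ z)).lineDeriv
    have a2 := (hasLineDerivAt_ι (S := S.toBanachScale) (F := X) (S.ι S.m)
      (zp.contDiffAt_x.differentiableAt (by simp)) (z1.mono fun y hy => hy.ι_x) (w₃ z)).lineDeriv
    rw [map_sub, ← a1, ← a2, hii, z4, hWz]
  intro h hh
  obtain ⟨s', hs', Js, hJs⟩ := S.J_bounded u
  obtain ⟨h', hh'⟩ := hh s'
  have e1 : S.incl hs' h' = h := S.ι_injective S.m (by rw [ι_incl, hh'])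
  obtain ⟨j, hj⟩ : ∃ j : B u, S.J h = S.ι u j := ⟨Js h', by rw [hJs, e1]⟩
  have hij : S.J h = S.ι t (i j) := by rw [hj, hii]
  have e2 : lineDeriv ℝ (fun z => lineDeriv ℝ F z (X z)) (S.ι u z) (S.J h) = f' z j := by
    rw [hj, ← hdz.1.fderiv]
    exact (hasLineDerivAt_ι_self (S := S.toBanachScale) (F := fun z => lineDeriv ℝ F z (X z))
      hdz.1.differentiableAt j).lineDeriv
  have hline : Tendsto (fun r : ℝ => z + r • j) (𝓝 0) (𝓝 z) := by
    have : Continuous fun r : ℝ => z + r • j := by fun_prop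
    simpa using this.tendsto 0
  have hlineD : HasDerivAt (fun r : ℝ => z + r • j) j 0 := by
    simpa using! ((hasDerivAt_id (0 : ℝ)).smul_const j).const_add z
  -- the mixed second derivatives of `F` and of `G`
  have strict : ∀ k : B t → B S.m, ContDiffAt ℝ 1 k (i z) →
      HasStrictFDerivAt (fun y => -⟪S.toE (k y), S.toE h⟫)
        (-((innerSL ℝ (S.toE h)).comp (S.toE.comp (fderiv ℝ k (i z))))) (i z) := by
    intro k hk
    have := ((innerSL ℝ (S.toE h)).comp S.toE).hasStrictFDerivAt.comp (i z)
      (hk.hasStrictFDerivAt (by simp))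
    refine (this.neg).congr_of_eventuallyEq (Eventually.of_forall fun y => ?_)
    simp [real_inner_comm]
  have mF := hasDerivAt_fderiv_of_hasStrictFDerivAt (j := i j)
    (z1.mono fun y hy => hy.contDiffAt_left.differentiableAt (by simp))
    (z1.mono fun y hy => hy.hamF.fderiv_eq (hy.contDiffAt_left.differentiableAt (by simp)) hij)
    (strict w₂ zp.contDiffAt_w) (x₃ z)
  have mG := hasDerivAt_fderiv_of_hasStrictFDerivAt (j := i j)
    (z1.mono fun y hy => hy.contDiffAt_right.differentiableAt (by simp))
    (z1.mono fun y hy => hy.hamG.fderiv_eq (hy.contDiffAt_right.differentiableAt (by simp)) hij)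
    (strict x₂ zp.contDiffAt_x) (w₃ z)
  have a2 : S.J (g (i z)) = S.ι t (x₃ z) := by rw [zp.J_grad, hii, z4]
  have dF1 : HasDerivAt (fun r : ℝ => fderiv ℝ F₂ (i z) (x₃ (z + r • j) - x₃ z))
      (fderiv ℝ F₂ (i z) (fderiv ℝ x₃ z j)) 0 := by
    have : HasFDerivAt x₃ (fderiv ℝ x₃ z) (z + (0 : ℝ) • j) := by
      simpa using (z2.differentiableAt (by simp)).hasFDerivAt
    exact (fderiv ℝ F₂ (i z)).hasFDerivAt.comp_hasDerivAt (0 : ℝ)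
      ((this.comp_hasDerivAt (0 : ℝ) hlineD).sub_const _)
  have dG1 : HasDerivAt (fun r : ℝ => fderiv ℝ G₂ (i z) (w₃ (z + r • j) - w₃ z))
      (fderiv ℝ G₂ (i z) (fderiv ℝ w₃ z j)) 0 := by
    have : HasFDerivAt w₃ (fderiv ℝ w₃ z) (z + (0 : ℝ) • j) := by
      simpa using (z3.differentiableAt (by simp)).hasFDerivAt
    exact (fderiv ℝ G₂ (i z)).hasFDerivAt.comp_hasDerivAt (0 : ℝ)
      ((this.comp_hasDerivAt (0 : ℝ) hlineD).sub_const _)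
  -- the increments of the fields along `j` are increments of the differentials
  have k1 : (fun r : ℝ => fderiv ℝ F₂ (i z) (x₃ (z + r • j) - x₃ z)) =ᶠ[𝓝 0] fun r =>
      -(fderiv ℝ G₂ (i z + r • i j) (w₃ z) - fderiv ℝ G₂ (i z) (w₃ z)) := by
    filter_upwards [hline.eventually hz] with r hr
    obtain ⟨y1, y2, y3, y4, y5⟩ := hr
    have yp := y1.self_of_nhds
    have a1 : S.J (g (i (z + r • j))) = S.ι t (x₃ (z + r • j)) := by rw [yp.J_grad, hii, y4]
    have a3 : S.J (g (i (z + r • j)) - g (i z)) = S.ι t (x₃ (z + r • j) - x₃ z) := by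
      rw [map_sub, map_sub, a1, a2]
    rw [zp.hamF.fderiv_eq (zp.contDiffAt_left.differentiableAt (by simp)) a3,
      ← map_smul, ← map_add, dG _ yp.grad,
      dG _ zp.grad, z5, map_sub, inner_sub_right, real_inner_comm (S.toE (w₂ (i z))),
      real_inner_comm (S.toE (w₂ (i z)))]
  have k2 : (fun r : ℝ => fderiv ℝ G₂ (i z) (w₃ (z + r • j) - w₃ z)) =ᶠ[𝓝 0] fun r =>
      -(fderiv ℝ F₂ (i z + r • i j) (x₃ z) - fderiv ℝ F₂ (i z) (x₃ z)) := by
    filter_upwards [hline.eventually hz] with r hr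
    obtain ⟨y1, y2, y3, y4, y5⟩ := hr
    have yp := y1.self_of_nhds
    rw [dG _ zp.grad, map_sub, y5, z5, ← map_smul, ← map_add,
      yp.hamF.fderiv_eq (yp.contDiffAt_left.differentiableAt (by simp)) a2,
      zp.hamF.fderiv_eq (zp.contDiffAt_left.differentiableAt (by simp)) a2,
      map_sub, inner_sub_right, real_inner_comm (S.toE (g (i z))),
      real_inner_comm (S.toE (g (i z)))]
    ring
  have r1 := dF1.unique (((mG.sub_const _).neg).congr_of_eventuallyEq k1)
  have r2 := dG1.unique (((mF.sub_const _).neg).congr_of_eventuallyEq k2)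
  rw [e2, hf']
  simp only [sub_apply, ContinuousLinearMap.comp_apply]
  rw [r1, r2, map_sub, inner_sub_left]
  simp [real_inner_comm]

theorem hasWeakField_iterBracket {G H : B 0 → ℝ} {X XH : B 0 → B 0}
    (hG : S.IsHamiltonianField G X) (hX : S.AlmostSmooth X) (hH : S.IsHamiltonianField H XH)
    (hXH : S.AlmostSmooth XH) (l : ℕ) :
    S.HasWeakField (iterBracket X H l) (iterLie X XH l) := by
  induction l with
  | zero => exact hH.hasWeakField hXH
  | succ l ih =>
    exact ih.bracket (almostSmooth_iff.2 ((almostSmooth_iff.1 hX).iterLie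
      (almostSmooth_iff.1 hXH) l)) hG hX

/-- The weak Hamiltonian field of the truncated Lie series of a function is the truncated Lie
series of its Hamiltonian field. -/
theorem exists_isHamVec_truncLie {G H : B 0 → ℝ} {X XH : B 0 → B 0}
    (hG : S.IsHamiltonianField G X) (hX : S.AlmostSmooth X) (hH : S.IsHamiltonianField H XH)
    (hXH : S.AlmostSmooth XH) (r : ℕ) :
    ∃ s : ℕ, ∀ t ≥ s, ∀ᶠ z in 𝓝 (0 : B t), ∀ ε : ℝ,
      ContDiffAt ℝ 1 (fun z : B t => truncLie X H r ε (S.ι t z)) z ∧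
      ∃ w : B S.m, S.ι S.m w = truncLieField X XH r ε (S.ι t z) ∧
        S.IsHamVec (truncLie X H r ε) (S.ι t z) w := by
  choose s hs using fun l => (hasWeakField_iterBracket hG hX hH hXH l).exists_forall_ge
  refine ⟨(Finset.range (r + 1)).sup s, fun t ht => ?_⟩
  have h1 : ∀ᶠ z in 𝓝 (0 : B t), ∀ l ∈ Finset.range (r + 1),
      ContDiffAt ℝ 1 (fun z : B t => iterBracket X H l (S.ι t z)) z ∧
      ∃ w : B S.m, S.ι S.m w = iterLie X XH l (S.ι t z) ∧
        S.IsHamVec (iterBracket X H l) (S.ι t z) w :=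
    (Filter.eventually_all_finset _).2 fun l hl => hs l t ((Finset.le_sup hl).trans ht)
  filter_upwards [h1] with z hz ε
  refine ⟨?_, ?_⟩
  · exact ContDiffAt.sum fun l hl => contDiffAt_const.mul (hz l hl).1
  choose! w hw hw' using fun l hl => (hz l hl).2
  refine ⟨∑ l ∈ Finset.range (r + 1), (ε ^ l / (l.factorial : ℝ)) • w l, ?_, ?_⟩
  · rw [map_sum, truncLieField]
    refine Finset.sum_congr rfl fun l hl => ?_
    rw [map_smul, hw l hl]
  · intro h hh
    obtain ⟨s', hs', Js, hJs⟩ := S.J_bounded t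
    obtain ⟨h', hh'⟩ := hh s'
    have e1 : S.incl hs' h' = h := S.ι_injective S.m (by rw [ι_incl, hh'])
    obtain ⟨j, hj⟩ : ∃ j : B t, S.J h = S.ι t j := ⟨Js h', by rw [hJs, e1]⟩
    have e2 : ∀ l ∈ Finset.range (r + 1), HasLineDerivAt ℝ (iterBracket X H l)
        (-⟪S.toE (w l), S.toE h⟫) (S.ι t z) (S.J h) := by
      intro l hl
      rw [hw' l hl h hh, neg_neg, hj]
      exact (hasLineDerivAt_ι_self ((hz l hl).1.differentiableAt (by simp)) j)
        |>.lineDifferentiableAt.hasLineDerivAt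
    have e3 := HasDerivAt.fun_sum fun l hl =>
      HasDerivAt.const_mul (ε ^ l / (l.factorial : ℝ)) (e2 l hl)
    rw [lineDeriv]
    refine Eq.trans ?_ (congrArg Neg.neg e3.deriv.symm)
    rw [map_sum, sum_inner, ← Finset.sum_neg_distrib]
    refine Finset.sum_congr rfl fun l _ => ?_
    rw [map_smul, real_inner_smul_left]
    ring

end HamiltonianScale

/-! ### Solutions of the truncated equations -/

theorem uniqueDiffOn_timeInterval {T₀ : EReal} (h : 0 < T₀) : UniqueDiffOn ℝ (timeInterval T₀) := by
  induction T₀ with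
  | bot => simp at h
  | top =>
    have : timeInterval ⊤ = univ := by ext; simp [timeInterval]
    rw [this]
    exact uniqueDiffOn_univ
  | coe a =>
    have ha : 0 < a := by exact_mod_cast h
    have : timeInterval (a : EReal) = Icc (-a) a := by
      ext t
      simp [timeInterval, abs_le]
    rw [this]
    exact uniqueDiffOn_Icc (by linarith)

namespace HamiltonianScale

open BanachScale

variable {B : ℕ → Type u} [∀ s, NormedAddCommGroup (B s)] [∀ s, NormedSpace ℝ (B s)]
  {E : Type*} [NormedAddCommGroup E] [InnerProductSpace ℝ E] {S : HamiltonianScale B E}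

/-- The truncated flow maps solutions of the truncated equations to approximate solutions of the
equations of `H`. -/
theorem exists_approximate_solution [∀ s, CompleteSpace (B s)] {G H : B 0 → ℝ} {X XH : B 0 → B 0}
    (hG : S.IsHamiltonianField G X) (hX : S.AlmostSmooth X) (hH : S.IsHamiltonianField H XH)
    (hXH : S.AlmostSmooth XH) (r s' : ℕ) :
    ∃ (s s'' : ℕ) (hs : S.m ≤ s) (hs'' : S.m ≤ s'') (_ : s' ≤ s'') (U : Set (B s))
        (ε₀ C : ℝ), IsOpen U ∧ 0 ∈ U ∧ 0 < ε₀ ∧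
      ∀ ε : ℝ, |ε| < ε₀ → ∀ T₀ : EReal, 0 < T₀ → ∀ ζ : ℝ → B s,
        ContDiffOn ℝ 1 ζ (timeInterval T₀) →
        (∀ t ∈ timeInterval T₀, ζ t ∈ U) →
        (∀ t ∈ timeInterval T₀, S.IsHamVec (truncLie X H r ε) (S.ι s (ζ t))
          (S.incl hs (derivWithin ζ (timeInterval T₀) t))) →
        ∃ (z : ℝ → B s'') (R : ℝ → B s'),
          ContDiffOn ℝ 1 z (timeInterval T₀) ∧ ContDiffOn ℝ 1 R (timeInterval T₀) ∧
          ∀ t ∈ timeInterval T₀,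
            S.ι s'' (z t) = truncFlow X r ε (S.ι s (ζ t)) ∧
            ‖R t‖ ≤ C ∧ ‖derivWithin R (timeInterval T₀) t‖ ≤ C ∧
            ∃ g : B S.m, S.IsGradientAt H hs'' (z t) g ∧
              S.ι s'' (derivWithin z (timeInterval T₀) t)
                = S.J g + ε ^ (r + 1) • S.ι s' (R t) := by
  have sX := almostSmooth_iff.1 hX
  have sY := almostSmooth_iff.1 hXH
  set T : B 0 × ℝ → B 0 := fun p => truncFlow X r p.2 p.1 with hT
  set W : B 0 × ℝ → B 0 := fun p => truncLieField X XH r p.2 p.1 with hW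
  have hT0 : T 0 = 0 := by simp [hT, truncFlow]
  obtain ⟨Q, sQ, hQ⟩ := sX.exists_conjugation_eq sY r
  obtain ⟨s₀, hs₀⟩ := S.eventually_nhdsE.1 hQ
  obtain ⟨s₁, hs₁⟩ := exists_isHamVec_truncLie hG hX hH hXH r
  obtain ⟨sH, hsH, hgrad⟩ := hH.exists_forall_ge
  obtain ⟨s'', hHs, hss⟩ : ∃ s'', sH ≤ s'' ∧ s' ≤ s'' := ⟨_, le_max_left _ _, le_max_right _ _⟩
  have hs'' : S.m ≤ s'' := hsH.trans hHs
  replace hgrad := hgrad s'' hHs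
  obtain ⟨t₁, τ₁, hτ₁⟩ := sX.truncFlow r 1 s''
  obtain ⟨t, ht, c, hc⟩ := sQ.exists_rep 1 s' t₁
  have hτ := hτ₁.mono ht
  generalize (fun p => τ₁ (S.inclE ht p)) = τ at hτ
  obtain ⟨s, hs, ω, hω⟩ := (sX.truncLieField sY r).exists_rep 0 t (max t (max S.m (max s₀ s₁)))
  have hts : t ≤ s := (le_max_left _ _).trans hs
  have hms : S.m ≤ s := ((le_max_left _ _).trans (le_max_right _ _)).trans hs
  have h0s : s₀ ≤ s :=
    (((le_max_left _ _).trans (le_max_right _ _)).trans (le_max_right _ _)).trans hs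
  have h1s : s₁ ≤ s :=
    (((le_max_right _ _).trans (le_max_right _ _)).trans (le_max_right _ _)).trans hs
  have he := S.eventually_ιE_mono
    (P := fun p => along T W 0 p - XH (T p) = p.2 ^ (r + 1) • Q p) h0s hs₀
  have ti := S.tendsto_inclE hts
  have fst0 : Tendsto Prod.fst (𝓝 (0 : B s × ℝ)) (𝓝 0) := continuous_fst.tendsto _
  have fst0' : Tendsto Prod.fst (𝓝 (0 : B s'' × ℝ)) (𝓝 0) := continuous_fst.tendsto _
  have bound : ∀ {V V' : Type u} [NormedAddCommGroup V] [NormedAddCommGroup V'] {f : V → V'}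
      {x : V}, ContinuousAt f x → ∀ᶠ y in 𝓝 x, ‖f y‖ ≤ ‖f x‖ + 1 := fun h =>
    (h.norm.eventually_lt continuousAt_const (lt_add_one _)).mono fun _ h => h.le
  have bc := bound hc.1.continuousAt
  have bc' := bound (hc.1.fderiv_right (m := 0) (by norm_num)).continuousAt
  have bω := bound hω.1.continuousAt
  set C₀ := ‖c 0‖ + 1
  set C₁ := ‖fderiv ℝ c 0‖ + 1
  set C₂ := ‖ω 0‖ + 1
  have hC₀ : 0 ≤ C₀ := by positivity
  have hC₁ : 0 ≤ C₁ := by positivity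
  have hC₂ : 0 ≤ C₂ := by positivity
  obtain ⟨δ, hδ, hball⟩ := Metric.eventually_nhds_iff_ball.1
    ((((ti.eventually (hτ.eventually_hasLineDerivAt (k := 0))).and (ti.eventually hτ.2)).and
    ((ti.eventually (hc.eventually_hasLineDerivAt (k := 0))).and (ti.eventually hc.2))).and
    ((((ti.eventually bc).and (ti.eventually bc')).and (bω.and hω.2)).and
    ((ti.eventually ((fst0'.comp (hτ.tendsto hT0)).eventually hgrad)).and
    ((fst0.eventually (hs₁ s h1s)).and he))))
  refine ⟨s, s'', hms, hs'', hss, Metric.ball 0 δ, δ, C₀ + C₁ * C₂, Metric.isOpen_ball,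
    Metric.mem_ball_self hδ, hδ, ?_⟩
  intro ε hε T₀ hT₀ ζ hζ hζU hsol
  set I := timeInterval T₀
  have hI : UniqueDiffOn ℝ I := uniqueDiffOn_timeInterval hT₀
  have hp : ∀ t ∈ I, (ζ t, ε) ∈ Metric.ball (0 : B s × ℝ) δ := by
    intro t ht
    rw [mem_ball_zero_iff, Prod.norm_def, max_lt_iff]
    exact ⟨by simpa using hζU t ht, hε⟩
  have hcurve : ContDiffOn ℝ 1 (fun t => S.inclE hts (ζ t, ε)) I :=
    (S.inclE hts).contDiff.comp_contDiffOn (hζ.prodMk contDiffOn_const)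
  -- by uniqueness of weak Hamiltonian vectors, `ζ` solves an equation with an almost smooth field
  have hder : ∀ t ∈ I, HasDerivWithinAt (fun t => S.inclE hts (ζ t, ε)) (ω (ζ t, ε), 0) I t := by
    intro t ht
    obtain ⟨-, ⟨⟨-, -, e1⟩, -, e2, -⟩⟩ := hball _ (hp t ht)
    obtain ⟨-, w, hw, hw'⟩ := e2 ε
    have e3 := hw'.unique (hsol t ht)
    have e4 : S.incl hts (derivWithin ζ I t) = ω (ζ t, ε) := by
      apply S.ι_injective
      rw [e1, ι_incl, ← S.toBanachScale.ι_incl hms, ← e3, hw, ιE_apply]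
    have e5 : HasDerivWithinAt ζ (derivWithin ζ I t) I t :=
      (hζ.differentiableOn (by simp) t ht).hasDerivWithinAt
    have e6 := (S.inclE hts).hasFDerivAt.comp_hasDerivWithinAt t
      (e5.prodMk (hasDerivWithinAt_const t I ε))
    refine e6.congr_deriv ?_
    rw [inclE_apply, e4]
  refine ⟨fun t => τ (S.inclE hts (ζ t, ε)), fun t => c (S.inclE hts (ζ t, ε)), ?_, ?_, ?_⟩
  · intro t ht
    have h1 := (hball _ (hp t ht)).1.1.1.1
    exact ContDiffAt.comp_contDiffWithinAt (g := τ) t (by simpa using h1) (hcurve t ht)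
  · intro t ht
    have h1 := (hball _ (hp t ht)).1.2.1.1
    exact ContDiffAt.comp_contDiffWithinAt (g := c) t (by simpa using h1) (hcurve t ht)
  intro t ht
  obtain ⟨⟨⟨⟨e1, e2⟩, e3⟩, ⟨e4, -⟩, e5⟩, ⟨⟨e6, e7⟩, e8, e9⟩, e10, -, e11⟩ := hball _ (hp t ht)
  have dz : derivWithin (fun t => τ (S.inclE hts (ζ t, ε))) I t
      = fderiv ℝ τ (S.inclE hts (ζ t, ε)) (ω (ζ t, ε), 0) :=
    ((e1.differentiableAt (by simp)).hasFDerivAt.comp_hasDerivWithinAt t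
      (hder t ht)).derivWithin (hI t ht)
  have dR : derivWithin (fun t => c (S.inclE hts (ζ t, ε))) I t
      = fderiv ℝ c (S.inclE hts (ζ t, ε)) (ω (ζ t, ε), 0) :=
    ((e4.differentiableAt (by simp)).hasFDerivAt.comp_hasDerivWithinAt t
      (hder t ht)).derivWithin (hI t ht)
  have e3' : S.ι s'' (τ (S.inclE hts (ζ t, ε))) = truncFlow X r ε (S.ι s (ζ t)) := by
    rw [e3, ιE_inclE, ιE_apply]
  obtain ⟨-, g, hg, hJ⟩ := e10
  refine ⟨e3', ?_, ?_, g, hg, ?_⟩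
  · exact e6.trans (le_add_of_nonneg_right (mul_nonneg hC₁ hC₂))
  · rw [dR]
    refine (ContinuousLinearMap.le_opNorm _ _).trans ?_
    refine le_trans ?_ (le_add_of_nonneg_left hC₀)
    have : ‖(ω (ζ t, ε), (0 : ℝ))‖ ≤ C₂ := by simpa [Prod.norm_def] using e8
    gcongr
  · have e12 := (e2 (ω (ζ t, ε), 0)).lineDeriv
    rw [ιE_inclE, ιE_apply S.toBanachScale _ (ω (ζ t, ε), 0)] at e12
    simp only [e9] at e12
    simp only [along] at e11
    rw [e12] at e11
    rw [dz, hJ, Function.comp_apply, e3', ← sub_eq_iff_eq_add', e5, ιE_inclE]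
    exact e11

end HamiltonianScale

end

theorem theorem4 {B : ℕ → Type*} [∀ s, NormedAddCommGroup (B s)] [∀ s, NormedSpace ℝ (B s)]
    [∀ s, CompleteSpace (B s)] {E : Type*} [NormedAddCommGroup E] [InnerProductSpace ℝ E]
    [CompleteSpace E] (S : HamiltonianScale B E) (r : ℕ) (hr : 1 ≤ r)
    (G H : B 0 → ℝ) (X XH : B 0 → B 0)
    (hG : S.IsHamiltonianField G X) (hX : S.AlmostSmooth X)
    (hH : S.IsHamiltonianField H XH) (hXH : S.AlmostSmooth XH) :
    -- the truncated Lie series is of class `C^1` and has an almost smooth Hamiltonian field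
    (∃ W : ℝ → B 0 → B 0, S.AlmostSmoothFamily W ∧
      ∃ (s : ℕ) (V : Set (B s)), IsOpen V ∧ 0 ∈ V ∧ ∀ ε : ℝ,
        ContDiffOn ℝ 1 (fun z : B s => truncLie X H r ε (S.ι s z)) V ∧
        ∀ z ∈ V, ∃ w : B S.m, S.ι S.m w = W ε (S.ι s z) ∧
          S.IsHamVec (truncLie X H r ε) (S.ι s z) w) ∧
    -- the truncated flow maps its solutions to approximate solutions of the equations of `H`
    (∀ s' : ℕ, ∃ (s s'' : ℕ) (hs : S.m ≤ s) (hs'' : S.m ≤ s'') (_ : s' ≤ s'') (U : Set (B s))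
        (ε₀ C : ℝ), IsOpen U ∧ 0 ∈ U ∧ 0 < ε₀ ∧
      ∀ ε : ℝ, |ε| < ε₀ → ∀ T₀ : EReal, 0 < T₀ → ∀ ζ : ℝ → B s,
        ContDiffOn ℝ 1 ζ (timeInterval T₀) →
        (∀ t ∈ timeInterval T₀, ζ t ∈ U) →
        (∀ t ∈ timeInterval T₀, S.IsHamVec (truncLie X H r ε) (S.ι s (ζ t))
          (S.incl hs (derivWithin ζ (timeInterval T₀) t))) →
        ∃ (z : ℝ → B s'') (R : ℝ → B s'),
          ContDiffOn ℝ 1 z (timeInterval T₀) ∧ ContDiffOn ℝ 1 R (timeInterval T₀) ∧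
          ∀ t ∈ timeInterval T₀,
            S.ι s'' (z t) = truncFlow X r ε (S.ι s (ζ t)) ∧
            ‖R t‖ ≤ C ∧ ‖derivWithin R (timeInterval T₀) t‖ ≤ C ∧
            ∃ g : B S.m, S.IsGradientAt H hs'' (z t) g ∧
              S.ι s'' (derivWithin z (timeInterval T₀) t)
                = S.J g + ε ^ (r + 1) • S.ι s' (R t)) := by
  refine ⟨⟨truncLieField X XH r, ?_, ?_⟩, fun s' =>
    HamiltonianScale.exists_approximate_solution hG hX hH hXH r s'⟩
  · exact BanachScale.Smooth.almostSmoothFamily (BanachScale.Smooth.truncLieField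
      (BanachScale.almostSmooth_iff.1 hX) (BanachScale.almostSmooth_iff.1 hXH) r)
  · obtain ⟨s, hs⟩ := HamiltonianScale.exists_isHamVec_truncLie hG hX hH hXH r
    obtain ⟨V, hV, hVo, h0⟩ := eventually_nhds_iff.1 (hs s le_rfl)
    exact ⟨s, V, hVo, h0, fun ε => ⟨fun z hz => (hV z hz ε).1.contDiffWithinAt,
      fun z hz => (hV z hz ε).2⟩⟩
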